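/- **Definitions.** Let $\mathcal I=\{x_1,\dots,x_n\}$ be a finite set of issues (propositional variables). A *ballot* is a map $r:\mathcal I\to\{0,1\}$. A *partial ballot* is a map $s:\mathcal I\to\{0,1,\star\}$; it *agrees with* a ballot $r$ if $s(x)=r(x)$ whenever $s(x)\neq\star$. An *NNF circuit* $\Gamma$ is a finite directed acyclic graph with a single root (a node without ingoing edges), in which each node is labelled with $\top$, $\bot$, a variable $v$ or a negated variable $\neg v$ (these nodes are leaves), or with $\wedge$ or $\vee$ (an empty conjunction is true, an empty disjunction false). The variables may be issues or auxiliary variables that are not issues. The truth value of $\Gamma$ under an assignment is that of its root. $\Gamma$ is a *DNNF circuit* if for every $\wedge$-node the subcircuits rooted at any two of its children have no variable in common. The set $\mathcal R(\mathcal I,\Gamma)$ of *rational ballots* consists of the ballots that are consistent with $\Gamma$, i.e. that can be extended to an assignment (of the auxiliary variables as well) satisfying $\Gamma$. A *profile* is a nonempty finite sequence $\boldsymbol r=(r_1,\dots,r_p)$ of rational ballots. - $\mathrm{Kemeny}(\boldsymbol r)$ is the set of all $r\in\mathcal R(\mathcal I,\Gamma)$ that maximize $\sum_{i=1}^{p}\sum_{l}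 r_i(l)$, where $l$ ranges over the literals $x,\neg x$ ($x\in\mathcal I$) with $r(l)=1$. - $\mathrm{Slater}(\boldsymbol r)$ is the set of all $r\in\mathcal R(\mathcal I,\Gamma)$ that minimize the Hamming distance $|\{x\in\mathcal I: r(x)\neq m_{\boldsymbol r}(x)\}|$ to the majority outcome $m_{\boldsymbol r}$, where $m_{\boldsymbol r}(x)$ is the value that a strict majority of $r_1,\dots,r_p$ give to $x$ if there is one, and $\star$ otherwise. For $F\in\{\mathrm{Kemeny},\mathrm{Slater}\}$, the decision problem $\mathrm{Outcome}(F)$ is: given $\mathcal I$, $\Gamma$, a profile $\boldsymbol r\in\mathcal R(\mathcal I,\Gamma)^+$ and a partial ballot $s$, is there a ballot $r^*\in F(\boldsymbol r)$ such that $s$ agrees with $r^*$? **Theorem.** $\mathrm{Outcome}(\mathrm{Kemeny})$ and $\mathrm{Outcome}(\mathrm{Slater})$ are polynomial-time computable when $\Gamma$ is a DNNF circuit. That is, for each of the two problems there is a deterministic (multi-stack) Turing machine and a polynomial $q$ such that on every instance $(\mathcal I,\Gamma,\boldsymbol r,s)$ in which $\Gamma$ is a DNNF circuit, written as a string $w$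 over a finite alphabet, the machine outputs the correct answer after at most $q(|w|)$ steps. (The string lists the nodes of $\Gamma$ with their labels and children, the ballots of $\boldsymbol r$, and $s$.) -/

import Mathlib

namespace JudgmentAggregation

/-! ### Ballots -/

/-- A ballot for the issues `x_0, …, x_{n-1}`: a truth assignment to the issues. -/
abbrev Ballot (n : ℕ) : Type := Fin n → Bool

/-- A partial ballot; the value `none` plays the role of `⋆`. -/
abbrev PartialBallot (n : ℕ) : Type := Fin n → Option Bool

/-- The partial ballot `s` agrees with the ballot `r`. -/
def PartialBallot.AgreesWith {n : ℕ} (s : PartialBallot n) (r : Ballot n) : Prop :=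
  ∀ i, s i ≠ none → s i = some (r i)

/-- Literals over the issues: `(i, true)` is `x_i` and `(i, false)` is `¬ x_i`. -/
abbrev IssueLit (n : ℕ) : Type := Fin n × Bool

/-- The truth value, `0` or `1`, that a ballot gives to a literal. -/
def litVal {n : ℕ} (r : Ballot n) (l : IssueLit n) : ℕ := if r l.1 = l.2 then 1 else 0

/-! ### Circuits in (decomposable) negation normal form -/

/-- The propositional variables that an integrity constraint may use: the `n` issues, and an
unlimited supply of auxiliary variables that are not issues. -/
abbrev Var (n : ℕ) : Type := Fin n ⊕ ℕ

/-- The label of a node of a circuit with `m` nodes, together with the children of that node.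
`lit v true` is the literal `v` and `lit v false` is the literal `¬ v`. -/
inductive Gate (n m : ℕ) : Type
  | top : Gate n m
  | bot : Gate n m
  | lit (v : Var n) (b : Bool) : Gate n m
  | conj (cs : List (Fin m)) : Gate n m
  | disj (cs : List (Fin m)) : Gate n m

/-- The children of a node. -/
def Gate.children {n m : ℕ} : Gate n m → List (Fin m)
  | .conj cs => cs
  | .disj cs => cs
  | _ => []

/-- A Boolean circuit in negation normal form: a finite directed acyclic graph with a single root
(a node without ingoing edges), whose nodes are labelled. -/
structure NNFCircuit (n : ℕ) : Type where
  /-- the number of nodes -/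
  size : ℕ
  /-- the labels and the outgoing edges of the nodes -/
  gate : Fin size → Gate n size
  /-- there is no directed cycle -/
  acyclic : ∀ i, ¬ Relation.TransGen (fun i c => c ∈ (gate i).children) i i
  /-- the root -/
  root : Fin size
  /-- the root is the one and only node without ingoing edges -/
  root_unique : ∀ i, (∀ j, i ∉ (gate j).children) ↔ i = root

namespace NNFCircuit

variable {n : ℕ} (C : NNFCircuit n)

/-- `C.Arc i c`: there is an arc from `i` to `c`, that is, `c` is a child of `i`. -/
def Arc (i c : Fin C.size) : Prop := c ∈ (C.gate i).children

theorem wellFounded_child : WellFounded fun c i => C.Arc i c := by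
  have h : WellFounded (Relation.TransGen fun c i => C.Arc i c) := by
    have : Std.Irrefl (Relation.TransGen fun c i => C.Arc i c) :=
      ⟨fun i hi => C.acyclic i (Relation.transGen_swap.mp hi)⟩
    exact Finite.wellFounded_of_trans_of_irrefl _
  exact Subrelation.wf (r := Relation.TransGen fun c i => C.Arc i c)
    (fun hab => Relation.TransGen.single hab) h

/-- The truth value of each node under an assignment to the variables. -/
noncomputable def value (α : Var n → Bool) : Fin C.size → Bool :=
  C.wellFounded_child.fix fun i rec =>
    match h : C.gate i with
    | .top => true
    | .bot => false
    | .lit v b => α v == b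
    | .conj cs => cs.attach.all fun c => rec c.1 (by
        show c.1 ∈ (C.gate i).children; rw [h]; exact c.2)
    | .disj cs => cs.attach.any fun c => rec c.1 (by
        show c.1 ∈ (C.gate i).children; rw [h]; exact c.2)

/-- The recursion that determines the truth values of the nodes. -/
theorem value_eq (α : Var n → Bool) (i : Fin C.size) :
    C.value α i =
      match C.gate i with
      | .top => true
      | .bot => false
      | .lit v b => α v == b
      | .conj cs => cs.all (C.value α)
      | .disj cs => cs.any (C.value α) := by
  rw [value, WellFounded.fix_eq]
  split <;> rename_i h <;> simp only [h]
  · change List.all (List.attach _) (fun c => C.value α c.1) = _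
    simp
    rfl
  · change List.any (List.attach _) (fun c => C.value α c.1) = _
    simp
    rfl

/-- The truth value of the circuit is the truth value of its root. -/
noncomputable def eval (α : Var n → Bool) : Bool := C.value α C.root

/-- The variables that occur in the subcircuit whose root is the node `i`. -/
def vars (i : Fin C.size) : Set (Var n) :=
  {v | ∃ j b, Relation.ReflTransGen C.Arc i j ∧ C.gate j = .lit v b}

/-- Decomposability: the conjuncts of a conjunction node do not share variables. A circuit in
negation normal form with this property is a DNNF circuit. -/
def Decomposable : Prop :=
  ∀ i cs, C.gate i = .conj cs → cs.Pairwise fun c d => Disjoint (C.vars c) (C.vars d)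

/-- The rational ballots: the ballots that are consistent with the integrity constraint, that is,
that can be extended to the auxiliary variables so that the circuit becomes true. When the circuit
has no auxiliary variables, these are the ballots that satisfy it. -/
def rational : Set (Ballot n) :=
  {r | ∃ β : ℕ → Bool, C.eval (Sum.elim r β) = true}

end NNFCircuit

/-! ### Judgment aggregation procedures -/

/-- A judgment aggregation procedure maps the issues, an integrity constraint and a profile to a
set of ballots. -/
abbrev Procedure : Type := (n : ℕ) → NNFCircuit n → List (Ballot n) → Set (Ballot n)

/-- The total score of the ballot `r` for a profile: the sum of the scores, with respect to all
ballots in the profile, of the literals that `r` makes true. -/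
def totalScore {n : ℕ} (score : Ballot n → IssueLit n → ℕ) (p : List (Ballot n))
    (r : Ballot n) : ℕ :=
  (p.map fun ri => ∑ l : IssueLit n with litVal r l = 1, score ri l).sum

/-- The scoring procedure of a scoring function: the rational ballots of maximal total score. -/
def scoringProcedure (score : (n : ℕ) → Ballot n → IssueLit n → ℕ) : Procedure :=
  fun n C p => {r | r ∈ C.rational ∧
    ∀ r' ∈ C.rational, totalScore (score n) p r' ≤ totalScore (score n) p r}

/-- The Kemeny (median) procedure: the scoring procedure of `s(r, l) = r(l)`. -/
def kemeny : Procedure := scoringProcedure fun _ r l => litVal r l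

/-- The majority outcome of a profile: on each issue, the value held by a strict majority of the
ballots, if there is one, and `⋆` otherwise. -/
def majority {n : ℕ} (p : List (Ballot n)) : PartialBallot n := fun i =>
  if p.length < 2 * p.countP (fun r => r i = true) then some true
  else if p.length < 2 * p.countP (fun r => r i = false) then some false
  else none

/-- The Hamming distance between a ballot and a partial ballot. -/
def hammingToPartial {n : ℕ} (r : Ballot n) (m : PartialBallot n) : ℕ :=
  (Finset.univ.filter fun i => some (r i) ≠ m i).card

/-- The Slater (max-card Condorcet) procedure: the rational ballots of minimal Hamming distance to
the majority outcome. -/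
def slater : Procedure :=
  fun _ C p => {r | r ∈ C.rational ∧
    ∀ r' ∈ C.rational, hammingToPartial r (majority p) ≤ hammingToPartial r' (majority p)}

/-! ### The outcome determination problem -/

/-- An instance of outcome determination whose integrity constraint is a DNNF circuit: issues, the
circuit, a nonempty finite sequence of rational ballots, and a partial ballot. -/
structure DNNFInstance : Type where
  /-- the number of issues -/
  n : ℕ
  /-- the integrity constraint -/
  circuit : NNFCircuit n
  /-- the integrity constraint is a DNNF circuit -/
  decomposable : circuit.Decomposable
  /-- the profile -/
  profile : List (Ballot n)
  profile_ne_nil : profile ≠ []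
  profile_rational : ∀ r ∈ profile, r ∈ circuit.rational
  /-- the partial ballot of the question -/
  query : PartialBallot n

open Classical in
/-- The answer to the question of the outcome determination problem for the procedure `F`: is there
a ballot in the outcome of `F` with which the given partial ballot agrees? -/
noncomputable def outcome (F : Procedure) (I : DNNFInstance) : Bool :=
  decide (∃ r ∈ F I.n I.circuit I.profile, I.query.AgreesWith r)

/-! ### Instances as strings

Truth values are written as bits, and the names of auxiliary variables in binary. The index of an
issue or a node is written in unary: it is smaller than the number of issues or of nodes, and the
ballots and the nodes are all listed in the string, so that this makes the string at most
quadratically longer than binary notation would. -/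

/-- The alphabet. -/
inductive Symbol : Type
  | tick
  | bit (b : Bool)
  | star
  | top
  | bot
  | issue (b : Bool)
  | aux (b : Bool)
  | conj
  | disj
  | sep
  | bar
  deriving DecidableEq, Fintype

/-- Unary notation. -/
def encodeIndex (k : ℕ) : List Symbol := List.replicate k .tick

/-- A list of nodes: each of them in unary, preceded by a separator. -/
def encodeChildren {m : ℕ} (cs : List (Fin m)) : List Symbol :=
  (cs.map fun c : Fin m => Symbol.sep :: encodeIndex c.val).flatten

/-- A node of a circuit: its label, followed by the index of its variable or by its children. -/
def Gate.encode {n m : ℕ} : Gate n m → List Symbol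
  | .top => [.top]
  | .bot => [.bot]
  | .lit (.inl i) b => .issue b :: encodeIndex i
  | .lit (.inr j) b => .aux b :: (Computability.encodeNat j).map .bit
  | .conj cs => .conj :: encodeChildren cs
  | .disj cs => .disj :: encodeChildren cs

/-- A ballot: a separator followed by a vector of bits. -/
def encodeBallot {n : ℕ} (r : Ballot n) : List Symbol :=
  .sep :: List.ofFn fun i => Symbol.bit (r i)

/-- A partial ballot: a vector with entries in `{0, 1, ⋆}`. -/
def encodePartialBallot {n : ℕ} (s : PartialBallot n) : List Symbol :=
  List.ofFn fun i => match s i with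
    | some b => Symbol.bit b
    | none => Symbol.star

/-- An instance: the number of issues, the root and the nodes of the circuit, the profile, and the
partial ballot. -/
def DNNFInstance.encode (I : DNNFInstance) : List Symbol :=
  encodeIndex I.n ++ .bar ::
  (encodeIndex I.circuit.root ++ .bar ::
  ((List.ofFn fun i => (I.circuit.gate i).encode).flatten ++ .bar ::
  ((I.profile.map encodeBallot).flatten ++ .bar ::
  encodePartialBallot I.query)))

/-! Different instances are encoded by different strings. -/

theorem append_cons_inj_of_notMem {A : Type} {x : A} {u u' v v' : List A}
    (hu : x ∉ u) (hu' : x ∉ u') (h : u ++ x :: v = u' ++ x :: v') : u = u' ∧ v = v' := by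
  induction u generalizing u' with
  | nil => cases u' with
    | nil => simpa using h
    | cons b t => simp only [List.nil_append, List.cons_append, List.cons.injEq] at h
                  exact absurd (h.1 ▸ List.mem_cons_self) hu'
  | cons a t ih => cases u' with
    | nil => simp only [List.nil_append, List.cons_append, List.cons.injEq] at h
             exact absurd (h.1 ▸ List.mem_cons_self) hu
    | cons b t' =>
      simp only [List.cons_append, List.cons.injEq, List.mem_cons, not_or] at h hu hu'
      obtain ⟨h1, h2⟩ := ih hu.2 hu'.2 h.2
      exact ⟨by rw [h.1, h1], h2⟩

/-- The words of a list can be recovered from their concatenation when each of them starts with a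
symbol of a kind `H` that does not occur later in the word. -/
theorem flatten_inj_of_head {A : Type} (H : A → Prop) {L L' : List (List A)}
    (hL : ∀ w ∈ L, ∃ a t, w = a :: t ∧ H a ∧ ∀ x ∈ t, ¬ H x)
    (hL' : ∀ w ∈ L', ∃ a t, w = a :: t ∧ H a ∧ ∀ x ∈ t, ¬ H x)
    (h : L.flatten = L'.flatten) : L = L' := by
  have key : ∀ {t t' : List A} {M M' : List (List A)}, (∀ x ∈ t, ¬ H x) → (∀ x ∈ t', ¬ H x) →
      (∀ w ∈ M, ∃ a s, w = a :: s ∧ H a ∧ ∀ x ∈ s, ¬ H x) →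
      (∀ w ∈ M', ∃ a s, w = a :: s ∧ H a ∧ ∀ x ∈ s, ¬ H x) →
      t ++ M.flatten = t' ++ M'.flatten → t = t' ∧ M.flatten = M'.flatten := by
    intro t
    induction t with
    | nil =>
      intro t' M M' _ ht' hM _ he
      cases t' with
      | nil => exact ⟨rfl, by simpa using he⟩
      | cons b s =>
        cases M with
        | nil => simp at he
        | cons w M =>
          obtain ⟨a, r, rfl, ha, _⟩ := hM w List.mem_cons_self
          simp only [List.nil_append, List.flatten_cons, List.cons_append, List.cons.injEq] at he
          exact absurd (he.1 ▸ ha) (ht' b List.mem_cons_self)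
    | cons a t ih =>
      intro t' M M' ht ht' hM hM' he
      cases t' with
      | nil =>
        cases M' with
        | nil => simp at he
        | cons w M' =>
          obtain ⟨b, r, rfl, hb, _⟩ := hM' w List.mem_cons_self
          simp only [List.nil_append, List.flatten_cons, List.cons_append, List.cons.injEq] at he
          exact absurd (he.1 ▸ hb) (ht a List.mem_cons_self)
      | cons b s =>
        simp only [List.cons_append, List.cons.injEq] at he
        obtain ⟨h1, h2⟩ := ih (fun x hx => ht x (List.mem_cons_of_mem _ hx))
          (fun x hx => ht' x (List.mem_cons_of_mem _ hx)) hM hM' he.2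
        exact ⟨by rw [he.1, h1], h2⟩
  induction L generalizing L' with
  | nil => cases L' with
    | nil => rfl
    | cons w L' =>
      obtain ⟨a, r, rfl, _⟩ := hL' w List.mem_cons_self
      simp at h
  | cons w L ih => cases L' with
    | nil =>
      obtain ⟨a, r, rfl, _⟩ := hL w List.mem_cons_self
      simp at h
    | cons w' L' =>
      obtain ⟨a, t, rfl, _, ht⟩ := hL w List.mem_cons_self
      obtain ⟨a', t', rfl, _, ht'⟩ := hL' w' List.mem_cons_self
      simp only [List.flatten_cons, List.cons_append, List.cons.injEq] at h
      have hM : ∀ w ∈ L, ∃ a t, w = a :: t ∧ H a ∧ ∀ x ∈ t, ¬ H x :=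
        fun w hw => hL w (List.mem_cons_of_mem _ hw)
      have hM' : ∀ w ∈ L', ∃ a t, w = a :: t ∧ H a ∧ ∀ x ∈ t, ¬ H x :=
        fun w hw => hL' w (List.mem_cons_of_mem _ hw)
      obtain ⟨h1, h2⟩ := key ht ht' hM hM' h.2
      rw [h.1, h1, ih hM hM' h2]

theorem encodeIndex_injective : Function.Injective encodeIndex := fun a b h => by
  simpa [encodeIndex] using congrArg List.length h

theorem mem_encodeIndex {x : Symbol} {k : ℕ} (h : x ∈ encodeIndex k) : x = .tick :=
  List.eq_of_mem_replicate h

theorem encodeChildren_injective {m : ℕ} :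
    Function.Injective (encodeChildren : List (Fin m) → List Symbol) := fun cs cs' h => by
  have hw : ∀ cs : List (Fin m), ∀ w ∈ cs.map fun c : Fin m => Symbol.sep :: encodeIndex c.val,
      ∃ a t, w = a :: t ∧ a = Symbol.sep ∧ ∀ x ∈ t, ¬ x = Symbol.sep := by
    intro cs w hw
    obtain ⟨c, _, rfl⟩ := List.mem_map.mp hw
    exact ⟨_, _, rfl, rfl, fun x hx => by simp [mem_encodeIndex hx]⟩
  refine List.map_injective_iff.mpr (fun c c' hc => ?_) (flatten_inj_of_head _ (hw cs) (hw cs') h)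
  simp only [List.cons.injEq, true_and] at hc
  exact Fin.ext (encodeIndex_injective hc)

theorem mem_encodeChildren {m : ℕ} {cs : List (Fin m)} {x : Symbol} (h : x ∈ encodeChildren cs) :
    x = .sep ∨ x = .tick := by
  simp only [encodeChildren, List.mem_flatten, List.mem_map] at h
  obtain ⟨w, ⟨c, _, rfl⟩, hx⟩ := h
  rcases List.mem_cons.mp hx with h | h
  · exact .inl h
  · exact .inr (mem_encodeIndex h)

theorem Gate.encode_injective {n m : ℕ} :
    Function.Injective (Gate.encode : Gate n m → List Symbol) := by
  intro g g' h
  rcases g with _ | _ | ⟨i | j, b⟩ | cs | cs <;> rcases g' with _ | _ | ⟨i' | j', b'⟩ | cs' | cs' <;>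
    simp only [Gate.encode, List.cons.injEq, reduceCtorEq, false_and, Symbol.issue.injEq,
      Symbol.aux.injEq, true_and] at h ⊢
  · obtain ⟨rfl, h⟩ := h
    rw [Fin.ext (encodeIndex_injective h)]
  · obtain ⟨rfl, h⟩ := h
    have := List.map_injective_iff.mpr (fun a b hab => by simpa using hab) h
    rw [Computability.encodingNatBool.encode_injective this]
  · rw [encodeChildren_injective h]
  · rw [encodeChildren_injective h]

/-- The symbols with which the string of a node can start. -/
def IsGateHead (x : Symbol) : Prop := ∀ b, x ≠ .tick ∧ x ≠ .bit b ∧ x ≠ .sep ∧ x ≠ .bar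

theorem Gate.encode_head {n m : ℕ} (g : Gate n m) :
    ∃ a t, g.encode = a :: t ∧ IsGateHead a ∧ ∀ x ∈ t, ¬ IsGateHead x ∧ x ≠ .bar := by
  have h1 : ¬ IsGateHead .tick := fun h => (h true).1 rfl
  have h2 : ¬ IsGateHead .sep := fun h => (h true).2.2.1 rfl
  have h3 : ∀ b, ¬ IsGateHead (.bit b) := fun b h => (h b).2.1 rfl
  rcases g with _ | _ | ⟨i | j, b⟩ | cs | cs <;>
    refine ⟨_, _, rfl, by simp [IsGateHead], fun x hx => ?_⟩
  · simp at hx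
  · simp at hx
  · rw [mem_encodeIndex hx]; exact ⟨h1, by simp⟩
  · obtain ⟨b, _, rfl⟩ := List.mem_map.mp hx; exact ⟨h3 b, by simp⟩
  · rcases mem_encodeChildren hx with rfl | rfl
    · exact ⟨h2, by simp⟩
    · exact ⟨h1, by simp⟩
  · rcases mem_encodeChildren hx with rfl | rfl
    · exact ⟨h2, by simp⟩
    · exact ⟨h1, by simp⟩

theorem bar_notMem_gates {n m : ℕ} (g : Fin m → Gate n m) :
    Symbol.bar ∉ (List.ofFn fun i => (g i).encode).flatten := by
  simp only [List.mem_flatten, List.mem_ofFn, not_exists, not_and]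
  rintro _ ⟨i, rfl⟩ hx
  obtain ⟨a, t, h, ha, ht⟩ := (g i).encode_head
  rw [h] at hx
  rcases List.mem_cons.mp hx with rfl | hx
  · exact (ha true).2.2.2 rfl
  · exact (ht _ hx).2 rfl

theorem bar_notMem_profile {n : ℕ} (p : List (Ballot n)) :
    Symbol.bar ∉ (p.map encodeBallot).flatten := by
  simp only [List.mem_flatten, List.mem_map, not_exists, not_and]
  rintro _ ⟨r, _, rfl⟩ hx
  simp [encodeBallot] at hx

theorem encodeProfile_injective {n : ℕ} :
    Function.Injective fun p : List (Ballot n) => (p.map encodeBallot).flatten := by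
  intro p p' h
  have hw : ∀ p : List (Ballot n), ∀ w ∈ p.map encodeBallot,
      ∃ a t, w = a :: t ∧ a = Symbol.sep ∧ ∀ x ∈ t, ¬ x = Symbol.sep := by
    intro p w hw
    obtain ⟨r, _, rfl⟩ := List.mem_map.mp hw
    refine ⟨_, _, rfl, rfl, fun x hx => ?_⟩
    obtain ⟨i, rfl⟩ := List.mem_ofFn.mp hx
    simp
  refine List.map_injective_iff.mpr (fun r r' hr => ?_) (flatten_inj_of_head _ (hw p) (hw p') h)
  simp only [encodeBallot, List.cons.injEq, true_and] at hr
  funext i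
  simpa using congrFun (List.ofFn_injective hr) i

theorem encodePartialBallot_injective {n : ℕ} :
    Function.Injective (encodePartialBallot : PartialBallot n → List Symbol) := by
  intro s s' h
  funext i
  have := congrFun (List.ofFn_injective h) i
  rcases hs : s i with _ | b <;> rcases hs' : s' i with _ | b' <;> simp_all

theorem DNNFInstance.encode_injective : Function.Injective DNNFInstance.encode := by
  rintro ⟨n, ⟨m, g, hac, root, hroot⟩, hd, p, hp, hr, s⟩
    ⟨n', ⟨m', g', hac', root', hroot'⟩, hd', p', hp', hr', s'⟩ h
  have hidx : ∀ k, Symbol.bar ∉ encodeIndex k := fun k hk => by simpa using mem_encodeIndex hk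
  obtain ⟨h1, h⟩ := append_cons_inj_of_notMem (hidx _) (hidx _) h
  obtain ⟨h2, h⟩ := append_cons_inj_of_notMem (hidx _) (hidx _) h
  obtain ⟨h3, h⟩ := append_cons_inj_of_notMem (bar_notMem_gates _) (bar_notMem_gates _) h
  obtain ⟨h4, h5⟩ := append_cons_inj_of_notMem (bar_notMem_profile _) (bar_notMem_profile _) h
  obtain rfl : n = n' := encodeIndex_injective h1
  have hw : ∀ (m : ℕ) (g : Fin m → Gate n m), ∀ w ∈ List.ofFn fun i => (g i).encode,
      ∃ a t, w = a :: t ∧ IsGateHead a ∧ ∀ x ∈ t, ¬ IsGateHead x := by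
    intro m g w hw
    obtain ⟨i, rfl⟩ := List.mem_ofFn.mp hw
    obtain ⟨a, t, h, ha, ht⟩ := (g i).encode_head
    exact ⟨a, t, h, ha, fun x hx => (ht x hx).1⟩
  have h3' := flatten_inj_of_head _ (hw m g) (hw m' g') h3
  obtain rfl : m = m' := by simpa using congrArg List.length h3'
  obtain rfl : g = g' := by
    funext i
    exact Gate.encode_injective (congrFun (List.ofFn_injective h3') i)
  obtain rfl : root = root' := Fin.ext (encodeIndex_injective h2)
  obtain rfl : p = p' := encodeProfile_injective h4
  obtain rfl : s = s' := encodePartialBallot_injective h5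
  rfl

end JudgmentAggregation

/-!
Why outcome determination is easy on DNNF circuits. Both procedures maximise a sum of weights: for
`w i b` the number of ballots that give the issue `i` the value `b` (Kemeny), or the indicator that
a strict majority does so (Slater), the outcome consists of the rational ballots `r` that maximise
`∑ i, w i (r i)`. Put `loss w i b = w i (!b) - w i b`, truncated at zero. Weight plus loss of
a ballot is a constant (`sum_add_sum_loss`), so the outcome consists of the rational ballots of
minimal total loss. On every issue one of the two values has loss zero. Therefore the circuit need
not be smooth: an issue that does not occur below a node can be completed at no cost, and the
minimal cost of making a node true satisfies the min-plus recursion "minimum at disjunctions, sum at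
conjunctions". The sum is correct because conjuncts have no variable in common
(`exists_common_assignment`, `sum_le_costOn`, `isMinCost_gateCost`). The partial ballot `s` of the
question is handled by changing the costs: on a decided issue the prescribed value becomes free and
the other one impossible, and the losses of the prescribed values are added at the end (`minLoss`).
The answer is yes exactly if this minimum, computed for `s`, does not exceed the unrestricted one
(`answer_encode_eq_true_iff`). All finite costs are below the length of the input, which serves as
infinity. The values of the nodes are found by passing over the list of nodes as often as there are
nodes, because after `k` passes they are correct for every node with fewer than `k` proper
descendants.

Why this takes polynomial time on a Turing machine. Programs over five stacks of bits (`Prog`) are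
compiled to statements of a multi-stack machine, one step for one step (`Runs.reaches`). Data are
binary trees in prefix notation, so that a tree on top of a stack can be delimited by counting.
A function is called `PolyTime` if some program replaces the code of an argument on top of the main
stack by the code of the value within a polynomial number of steps. This class contains the basic
operations on pairs, lists and unary numbers and is closed under composition, case distinction and
under folding over a list with a step that enlarges the accumulator by a polynomial amount only
(`PolyTime.foldl`). The algorithm is an ordinary function on lists (`answer`), built from such
operations, and `PolyTime.computable` turns it into a machine.
-/

namespace StackProgram

open Function Turing

/-! ### Stack programs -/

/-- The stacks of a stack program: `main` holds arguments and values, `dump` holds lists that are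
being folded over, the others are scratch space. -/
inductive Reg : Type
  | main
  | dump
  | left
  | right
  | count
  deriving DecidableEq

instance : Fintype Reg :=
  ⟨{.main, .dump, .left, .right, .count}, fun r => by cases r <;> decide⟩

/-- The contents of the stacks; the head of a list is the top of the stack. -/
abbrev Store : Type := Reg → List Bool

/-- Programs on stacks of bits. `cond r p q` pops `r` and continues with `p` or `q` according to the
bit; `loop r p` pops `r` and runs `p` as long as the bit popped is `true`; `drain r p q` pops `r`
until it is empty and runs `p` or `q` for each bit. -/
inductive Prog : Type
  | skip : Prog
  | push (r : Reg) (x : Bool) : Prog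
  | seq (p q : Prog) : Prog
  | cond (r : Reg) (p q : Prog) : Prog
  | loop (r : Reg) (p : Prog) : Prog
  | drain (r : Reg) (p q : Prog) : Prog

/-- `Runs p k s s'`: started in the store `s`, the program `p` ends in the store `s'` after `k`
steps. A `cond` on an empty stack has no run. -/
inductive Runs : Prog → ℕ → Store → Store → Prop
  | skip (s : Store) : Runs .skip 1 s s
  | push (r : Reg) (x : Bool) (s : Store) : Runs (.push r x) 1 s (update s r (x :: s r))
  | seq {p q : Prog} {k k' : ℕ} {s s' s'' : Store} :
      Runs p k s s' → Runs q k' s' s'' → Runs (.seq p q) (k + k') s s''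
  | cond_true {r : Reg} {p q : Prog} {k : ℕ} {s s' : Store} {l : List Bool} :
      s r = true :: l → Runs p k (update s r l) s' → Runs (.cond r p q) (1 + k) s s'
  | cond_false {r : Reg} {p q : Prog} {k : ℕ} {s s' : Store} {l : List Bool} :
      s r = false :: l → Runs q k (update s r l) s' → Runs (.cond r p q) (1 + k) s s'
  | loop_step {r : Reg} {p : Prog} {k k' : ℕ} {s s' s'' : Store} {l : List Bool} :
      s r = true :: l → Runs p k (update s r l) s' → Runs (.loop r p) k' s' s'' →
      Runs (.loop r p) (1 + k + k') s s''
  | loop_exit {r : Reg} {p : Prog} {s : Store} :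
      (s r).head? ≠ some true → Runs (.loop r p) 1 s (update s r (s r).tail)
  | drain_true {r : Reg} {p q : Prog} {k k' : ℕ} {s s' s'' : Store} {l : List Bool} :
      s r = true :: l → Runs p k (update s r l) s' → Runs (.drain r p q) k' s' s'' →
      Runs (.drain r p q) (1 + k + k') s s''
  | drain_false {r : Reg} {p q : Prog} {k k' : ℕ} {s s' s'' : Store} {l : List Bool} :
      s r = false :: l → Runs q k (update s r l) s' → Runs (.drain r p q) k' s' s'' →
      Runs (.drain r p q) (1 + k + k') s s''
  | drain_nil {r : Reg} {p q : Prog} {s : Store} :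
      s r = [] → Runs (.drain r p q) 1 s s

/-- A step pushes at most one bit. Hence running time bounds the size of the output. -/
theorem Runs.length_le {p : Prog} {k : ℕ} {s s' : Store} (h : Runs p k s s') (r : Reg) :
    (s' r).length ≤ (s r).length + k := by
  have upd : ∀ (s : Store) (r₀ : Reg) (x : Bool) (l : List Bool), s r₀ = x :: l →
      (update s r₀ l r).length ≤ (s r).length := by
    intro s r₀ x l hl
    by_cases hr : r = r₀
    · subst hr; simp [hl]
    · simp [hr]
  induction h with
  | skip s => omega
  | push r₀ x s =>
    by_cases hr : r = r₀
    · subst hr; simp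
    · simp [hr]
  | seq _ _ h₁ h₂ => omega
  | cond_true h _ ih | cond_false h _ ih => have := upd _ _ _ _ h; omega
  | loop_step h _ _ ih ih' | drain_true h _ _ ih ih' | drain_false h _ _ ih ih' =>
    have := upd _ _ _ _ h; omega
  | @loop_exit r₀ p s h =>
    by_cases hr : r = r₀
    · subst hr; simp; omega
    · simp [hr]
  | drain_nil h => omega

/-! ### Compilation to multi-stack machines -/

/-- The labels of the machine code of a program, one for each place where the machine takes a step.
-/
def Label : Prog → Type
  | .skip => Unit
  | .push _ _ => Unit
  | .seq p q => Label p ⊕ Label q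
  | .cond _ p q => Option (Label p ⊕ Label q)
  | .loop _ p => Option (Label p)
  | .drain _ p q => Option (Label p ⊕ Label q)

noncomputable instance Label.fintype : (p : Prog) → Fintype (Label p)
  | .skip => inferInstanceAs (Fintype Unit)
  | .push _ _ => inferInstanceAs (Fintype Unit)
  | .seq p q =>
    have := Label.fintype p
    have := Label.fintype q
    inferInstanceAs (Fintype (Label p ⊕ Label q))
  | .cond _ p q | .drain _ p q =>
    have := Label.fintype p
    have := Label.fintype q
    inferInstanceAs (Fintype (Option (Label p ⊕ Label q)))
  | .loop _ p =>
    have := Label.fintype p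
    inferInstanceAs (Fintype (Option (Label p)))

/-- The label at which the machine code of a program starts. -/
def entry : (p : Prog) → Label p
  | .skip => ()
  | .push _ _ => ()
  | .seq p _ => Sum.inl (entry p)
  | .cond _ _ _ => (none : Option _)
  | .loop _ _ => (none : Option _)
  | .drain _ _ _ => (none : Option _)

section Machine

variable (A : Type)

/-- The stack alphabets of the machine: the input alphabet for the input stack `none`, bits for the
stacks of the program. -/
def Alphabet : Option Reg → Type
  | none => A
  | some _ => Bool

/-- The internal memory of the machine: the symbol popped last, or `none` between two steps. -/
abbrev Memory : Type := Option (A ⊕ Bool)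

variable {A}

/-- Pop a stack of the program into the memory. -/
def popThen {Λ : Type} (r : Reg) (q : TM2.Stmt (Alphabet A) Λ (Memory A)) :
    TM2.Stmt (Alphabet A) Λ (Memory A) :=
  .pop (some r) (fun _ (o : Option Bool) => o.map Sum.inr) q

/-- The symbol popped last is the bit `x`. -/
def isBit (x : Bool) : Memory A → Bool
  | some (.inr y) => x == y
  | _ => false

/-- Clear the memory and go to a label. -/
def jump {Λ : Type} (l : Λ) : TM2.Stmt (Alphabet A) Λ (Memory A) :=
  .load (fun _ => none) (.goto fun _ => l)

/-- The machine code of a program. The labels of the program are embedded into the labels of the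
machine by `emb`, and `exit` is the label to go to at the end. -/
def stmt {Λ : Type} : (p : Prog) → (Label p → Λ) → Λ → Label p →
    TM2.Stmt (Alphabet A) Λ (Memory A)
  | .skip, _, exit, _ => jump exit
  | .push r x, _, exit, _ => .push (some r) (fun _ => x) (jump exit)
  | .seq p _, emb, _, Sum.inl l => stmt p (fun l => emb (Sum.inl l)) (emb (Sum.inr (entry _))) l
  | .seq _ q, emb, exit, Sum.inr l => stmt q (fun l => emb (Sum.inr l)) exit l
  | .cond r p q, emb, _, none =>
    popThen r (.branch (isBit true) (jump (emb (some (Sum.inl (entry p)))))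
      (jump (emb (some (Sum.inr (entry q))))))
  | .cond _ p _, emb, exit, some (Sum.inl l) => stmt p (fun l => emb (some (Sum.inl l))) exit l
  | .cond _ _ q, emb, exit, some (Sum.inr l) => stmt q (fun l => emb (some (Sum.inr l))) exit l
  | .loop r p, emb, exit, none =>
    popThen r (.branch (isBit true) (jump (emb (some (entry p)))) (jump exit))
  | .loop _ p, emb, _, some l => stmt p (fun l => emb (some l)) (emb none) l
  | .drain r p q, emb, exit, none =>
    popThen r (.branch (isBit true) (jump (emb (some (Sum.inl (entry p)))))
      (.branch (isBit false) (jump (emb (some (Sum.inr (entry q))))) (jump exit)))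
  | .drain _ p _, emb, _, some (Sum.inl l) => stmt p (fun l => emb (some (Sum.inl l))) (emb none) l
  | .drain _ _ q, emb, _, some (Sum.inr l) => stmt q (fun l => emb (some (Sum.inr l))) (emb none) l

/-- The stacks of the machine, given the input stack and the store of the program. -/
def contents (w : List A) (s : Store) : (k : Option Reg) → List (Alphabet A k)
  | none => w
  | some r => s r

theorem update_contents (w : List A) (s : Store) (r : Reg) (l : List Bool) :
    update (contents w s) (some r) l = contents w (update s r l) := by
  funext k
  rcases k with _ | r'
  · rfl
  · by_cases h : r' = r
    · subst h
      exact (update_self (β := fun k => List (Alphabet A k)) (some r') l (contents w s)).trans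
        (update_self r' l s).symm
    · exact (update_of_ne (β := fun k => List (Alphabet A k)) (fun h' => h (Option.some.inj h')) l
        (contents w s)).trans (update_of_ne (β := fun _ => List Bool) h l s).symm

theorem stepAux_popThen {Λ : Type} (w : List A) (s : Store) (r : Reg) (v : Memory A)
    (q : TM2.Stmt (Alphabet A) Λ (Memory A)) :
    TM2.stepAux (popThen r q) v (contents w s) =
      TM2.stepAux q ((s r).head?.map Sum.inr) (contents w (update s r (s r).tail)) := by
  rw [← update_contents]; rfl

/-- The machine gets from one configuration to another in exactly `k` steps. -/
def Reaches {Λ : Type} (M : Λ → TM2.Stmt (Alphabet A) Λ (Memory A)) (k : ℕ)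
    (c c' : TM2.Cfg (Alphabet A) Λ (Memory A)) : Prop :=
  (flip bind (TM2.step M))^[k] (some c) = some c'

variable {Λ : Type} {M : Λ → TM2.Stmt (Alphabet A) Λ (Memory A)}

theorem Reaches.trans {k k' : ℕ} {c c' c'' : TM2.Cfg (Alphabet A) Λ (Memory A)}
    (h : Reaches M k c c') (h' : Reaches M k' c' c'') : Reaches M (k + k') c c'' := by
  unfold Reaches at *
  rw [Nat.add_comm, iterate_add_apply, h, h']

theorem Reaches.of_step {l : Λ} {w : List A} {s : Store}
    {v : Memory A} {c : TM2.Cfg (Alphabet A) Λ (Memory A)}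
    (h : TM2.stepAux (M l) v (contents w s) = c) : Reaches M 1 ⟨some l, v, contents w s⟩ c :=
  congrArg some h

/-- A machine that contains the code of a program simulates it step by step. -/
theorem Runs.reaches {p : Prog} {k : ℕ} {s s' : Store} (h : Runs p k s s') :
    ∀ (w : List A) (emb : Label p → Λ) (exit : Λ), (∀ l, M (emb l) = stmt p emb exit l) →
      Reaches M k ⟨some (emb (entry p)), none, contents w s⟩ ⟨some exit, none, contents w s'⟩ := by
  induction h with
  | skip s =>
    intro w emb exit hM
    exact Reaches.of_step (by rw [hM]; rfl)
  | push r x s =>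
    intro w emb exit hM
    refine Reaches.of_step ?_
    rw [hM, ← update_contents]; rfl
  | seq _ _ ih ih' =>
    intro w emb exit hM
    exact (ih w _ _ fun l => hM (Sum.inl l)).trans (ih' w _ _ fun l => hM (Sum.inr l))
  | cond_true hs _ ih =>
    intro w emb exit hM
    refine Reaches.trans (Reaches.of_step ?_) (ih w _ _ fun l => hM (some (Sum.inl l)))
    rw [hM]
    exact (stepAux_popThen ..).trans (by rw [hs]; rfl)
  | cond_false hs _ ih =>
    intro w emb exit hM
    refine Reaches.trans (Reaches.of_step ?_) (ih w _ _ fun l => hM (some (Sum.inr l)))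
    rw [hM]
    exact (stepAux_popThen ..).trans (by rw [hs]; rfl)
  | loop_step hs _ _ ih ih' =>
    intro w emb exit hM
    refine Reaches.trans (Reaches.trans (Reaches.of_step ?_) (ih w _ _ fun l => hM (some l)))
      (ih' w _ _ hM)
    rw [hM]
    exact (stepAux_popThen ..).trans (by rw [hs]; rfl)
  | @loop_exit r p s hs =>
    intro w emb exit hM
    refine Reaches.of_step ?_
    rw [hM]
    have : isBit (A := A) true (Option.map Sum.inr (s r).head?) = false := by
      rcases h : (s r).head? with _ | _ | _ <;> simp_all [isBit]
    refine (stepAux_popThen ..).trans ?_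
    rw [TM2.stepAux, this]; rfl
  | drain_true hs _ _ ih ih' =>
    intro w emb exit hM
    refine Reaches.trans (Reaches.trans (Reaches.of_step ?_)
      (ih w _ _ fun l => hM (some (Sum.inl l)))) (ih' w _ _ hM)
    rw [hM]
    exact (stepAux_popThen ..).trans (by rw [hs]; rfl)
  | drain_false hs _ _ ih ih' =>
    intro w emb exit hM
    refine Reaches.trans (Reaches.trans (Reaches.of_step ?_)
      (ih w _ _ fun l => hM (some (Sum.inr l)))) (ih' w _ _ hM)
    rw [hM]
    exact (stepAux_popThen ..).trans (by rw [hs]; rfl)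
  | @drain_nil r p q s hs =>
    intro w emb exit hM
    refine Reaches.of_step ?_
    rw [hM]
    refine (stepAux_popThen ..).trans ?_
    have : update s r (s r).tail = s := by rw [hs, List.tail_nil, ← hs, update_eq_self]
    rw [this, hs]; rfl

end Machine

/-! ### Trees on stacks -/

/-- Binary trees, the universal data type. -/
inductive Tree : Type
  | leaf : Tree
  | node (l r : Tree) : Tree

/-- Prefix notation. No bracket is needed: reading a word, one knows when the tree is complete. -/
def Tree.word : Tree → List Bool
  | .leaf => [false]
  | .node l r => true :: (l.word ++ r.word)

/-- A store, given by the contents of its five stacks. -/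
def store (m d l r c : List Bool) : Store
  | .main => m
  | .dump => d
  | .left => l
  | .right => r
  | .count => c

/-- A store whose scratch stacks are empty, as it is between two operations. -/
abbrev idle (m d : List Bool) : Store := store m d [] [] []

section
variable (m d l r c x : List Bool)
@[simp] theorem update_store_main : update (store m d l r c) .main x = store x d l r c := by
  funext i; cases i <;> rfl
@[simp] theorem update_store_dump : update (store m d l r c) .dump x = store m x l r c := by
  funext i; cases i <;> rfl
@[simp] theorem update_store_left : update (store m d l r c) .left x = store m d x r c := by
  funext i; cases i <;> rfl
@[simp] theorem update_store_right : update (store m d l r c) .right x = store m d l x c := by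
  funext i; cases i <;> rfl
@[simp] theorem update_store_count : update (store m d l r c) .count x = store m d l r x := by
  funext i; cases i <;> rfl
@[simp] theorem store_main : store m d l r c .main = m := rfl
@[simp] theorem store_dump : store m d l r c .dump = d := rfl
@[simp] theorem store_left : store m d l r c .left = l := rfl
@[simp] theorem store_right : store m d l r c .right = r := rfl
@[simp] theorem store_count : store m d l r c .count = c := rfl
end

/-- The program gets from one store to another in at most `b` steps. -/
def RunsIn (p : Prog) (b : ℕ) (s s' : Store) : Prop := ∃ k ≤ b, Runs p k s s'

namespace RunsIn

variable {p q : Prog} {r : Reg} {b b' : ℕ} {s s' s'' : Store} {l : List Bool}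

theorem mono (h : RunsIn p b s s') (hb : b ≤ b') : RunsIn p b' s s' := by
  obtain ⟨k, hk, h⟩ := h
  exact ⟨k, hk.trans hb, h⟩

theorem skip (s : Store) : RunsIn .skip 1 s s := ⟨_, le_rfl, .skip s⟩

theorem push (r : Reg) (x : Bool) (s : Store) :
    RunsIn (.push r x) 1 s (update s r (x :: s r)) := ⟨_, le_rfl, .push r x s⟩

theorem seq (h : RunsIn p b s s') (h' : RunsIn q b' s' s'') :
    RunsIn (.seq p q) (b + b') s s'' := by
  obtain ⟨k, hk, h⟩ := h
  obtain ⟨k', hk', h'⟩ := h'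
  exact ⟨_, add_le_add hk hk', h.seq h'⟩

theorem cond_true (hs : s r = true :: l) (h : RunsIn p b (update s r l) s') :
    RunsIn (.cond r p q) (1 + b) s s' := by
  obtain ⟨k, hk, h⟩ := h
  exact ⟨_, Nat.add_le_add_left hk 1, .cond_true hs h⟩

theorem cond_false (hs : s r = false :: l) (h : RunsIn q b (update s r l) s') :
    RunsIn (.cond r p q) (1 + b) s s' := by
  obtain ⟨k, hk, h⟩ := h
  exact ⟨_, Nat.add_le_add_left hk 1, .cond_false hs h⟩

theorem loop_step (hs : s r = true :: l) (h : RunsIn p b (update s r l) s')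
    (h' : RunsIn (.loop r p) b' s' s'') : RunsIn (.loop r p) (1 + b + b') s s'' := by
  obtain ⟨k, hk, h⟩ := h
  obtain ⟨k', hk', h'⟩ := h'
  exact ⟨_, by omega, .loop_step hs h h'⟩

theorem loop_exit (hs : (s r).head? ≠ some true) :
    RunsIn (.loop r p) 1 s (update s r (s r).tail) := ⟨_, le_rfl, .loop_exit hs⟩

end RunsIn

/-! ### Moving trees between stacks -/

/-- Move everything from one stack to another, which reverses the order. -/
abbrev pour (x y : Reg) : Prog := .drain x (.push y true) (.push y false)

theorem runsIn_pour {x y : Reg} (hxy : x ≠ y) (l : List Bool) (s : Store) (hs : s x = l) :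
    RunsIn (pour x y) (2 * l.length + 1) s (update (update s x []) y (l.reverse ++ s y)) := by
  induction l generalizing s with
  | nil =>
    have : update (update s x []) y ([].reverse ++ s y) = s := by
      funext i
      simp only [update_apply]
      split_ifs <;> simp_all
    rw [this]
    exact ⟨1, le_rfl, .drain_nil hs⟩
  | cons a l ih =>
    obtain ⟨k, hk, h⟩ := ih (update (update s x l) y (a :: s y)) (by simp [hxy])
    have key : update (update (update s x l) y (a :: s y)) x [] =
        update (update s x []) y (a :: s y) := by
      funext i
      simp only [update_apply]
      split_ifs <;> simp_all
    have hy : update s x l y = s y := update_of_ne (β := fun _ => List Bool) hxy.symm _ _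
    rw [key, update_self, update_idem, ← List.singleton_append, ← List.append_assoc,
      ← List.reverse_cons] at h
    have hp : Runs (.push y a) 1 (update s x l) (update (update s x l) y ([a] ++ s y)) := by
      rw [← hy]; exact .push y a _
    refine ⟨1 + 1 + k, by simp; omega, ?_⟩
    cases a
    · exact .drain_false hs hp h
    · exact .drain_true hs hp h

/-- The loop of `take`: the stack `count` holds one `true` for each tree that has to be read.
Reading `false` (a leaf) completes one tree, reading `true` (a node) leaves two more. -/
abbrev takeLoop (x y : Reg) : Prog :=
  .loop .count (.cond x (.seq (.push y true) (.seq (.push .count true) (.push .count true)))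
    (.push y false))

/-- Move one tree from a stack to another, which reverses its word. -/
def take (x y : Reg) : Prog := .seq (.push .count true) (takeLoop x y)

theorem runsIn_takeLoop {x y : Reg} (hxy : x ≠ y) (hx : x ≠ .count) (hy : y ≠ .count) (t : Tree)
    (m c : List Bool) (s s'' : Store) (b : ℕ) (hs : s x = t.word ++ m) (hc : s .count = true :: c)
    (h : RunsIn (takeLoop x y) b
      (update (update (update s x m) y (t.word.reverse ++ s y)) .count c) s'') :
    RunsIn (takeLoop x y) (b + 5 * t.word.length) s s'' := by
  induction t generalizing m c s b with
  | leaf =>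
    refine (RunsIn.loop_step hc (.cond_false (l := m) ?_ (.push _ _ _)) (b' := b) ?_).mono
      (by simp [Tree.word]; omega)
    · simpa [hx, Tree.word] using hs
    · convert h using 1
      funext i
      simp only [update_apply, Tree.word]
      split_ifs <;> simp_all
  | node t₁ t₂ ih₁ ih₂ =>
    refine (RunsIn.loop_step hc (.cond_true (l := t₁.word ++ (t₂.word ++ m)) ?_
      (.seq (.push _ _ _) (.seq (.push _ _ _) (.push _ _ _)))) (ih₁ (t₂.word ++ m) (true :: c) _
        (b + 5 * t₂.word.length) ?_ ?_ (ih₂ m c _ _ ?_ ?_ ?_))).mono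
      (by simp [Tree.word]; omega)
    · simpa [hx, Tree.word] using hs
    · simp [update_apply, hx, hxy]
    · simp [update_apply, hy.symm, hx.symm]
    · simp [update_apply, hx, hxy]
    · simp
    · convert h using 1
      funext i
      simp only [update_apply, Tree.word]
      split_ifs <;> simp_all

theorem runsIn_take {x y : Reg} (hxy : x ≠ y) (hx : x ≠ .count) (hy : y ≠ .count) (t : Tree)
    (m : List Bool) (s : Store) (hs : s x = t.word ++ m) (hc : s .count = []) :
    RunsIn (take x y) (5 * t.word.length + 2) s
      (update (update s x m) y (t.word.reverse ++ s y)) := by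
  refine (RunsIn.seq (.push _ _ _) (runsIn_takeLoop hxy hx hy t m [] _ _ 1 ?_ ?_ ?_)).mono
    (b' := _) (by omega)
  · simpa [hx] using hs
  · simp [hc]
  · have := RunsIn.loop_exit (r := .count) (p := .cond x (.seq (.push y true)
      (.seq (.push .count true) (.push .count true))) (.push y false))
      (s := update (update s x m) y (t.word.reverse ++ s y)) (by simp [hx.symm, hy.symm, hc])
    convert this using 1
    · funext i
      simp only [update_apply]
      split_ifs <;> simp_all
    · funext i
      simp only [update_apply]
      split_ifs <;> simp_all

/-! ### Stack manipulation -/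

/-- Remove the topmost tree. -/
def dropTree : Prog := .seq (take .main .left) (.drain .left .skip .skip)

theorem runsIn_discard (l m d r c : List Bool) :
    RunsIn (.drain .left .skip .skip) (2 * l.length + 1) (store m d l r c) (store m d [] r c) := by
  induction l with
  | nil => exact ⟨1, le_rfl, .drain_nil rfl⟩
  | cons a l ih =>
    obtain ⟨k, hk, h⟩ := ih
    refine ⟨1 + 1 + k, by simp; omega, ?_⟩
    cases a
    · exact .drain_false rfl (.skip _) (by simpa using h)
    · exact .drain_true rfl (.skip _) (by simpa using h)

theorem runsIn_take_main_left (t : Tree) (m d l r : List Bool) :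
    RunsIn (take .main .left) (5 * t.word.length + 2) (store (t.word ++ m) d l r [])
      (store m d (t.word.reverse ++ l) r []) := by
  simpa using runsIn_take (x := .main) (y := .left) (by decide) (by decide) (by decide) t m
    (store (t.word ++ m) d l r []) rfl rfl

theorem runsIn_take_main_right (t : Tree) (m d l r : List Bool) :
    RunsIn (take .main .right) (5 * t.word.length + 2) (store (t.word ++ m) d l r [])
      (store m d l (t.word.reverse ++ r) []) := by
  simpa using runsIn_take (x := .main) (y := .right) (by decide) (by decide) (by decide) t m
    (store (t.word ++ m) d l r []) rfl rfl

theorem runsIn_take_dump_left (t : Tree) (m d l r : List Bool) :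
    RunsIn (take .dump .left) (5 * t.word.length + 2) (store m (t.word ++ d) l r [])
      (store m d (t.word.reverse ++ l) r []) := by
  simpa using runsIn_take (x := .dump) (y := .left) (by decide) (by decide) (by decide) t d
    (store m (t.word ++ d) l r []) rfl rfl

theorem runsIn_pour_left_main (w m d r c : List Bool) :
    RunsIn (pour .left .main) (2 * w.length + 1) (store m d w.reverse r c)
      (store (w ++ m) d [] r c) := by
  simpa using runsIn_pour (x := .left) (y := .main) (by decide) w.reverse
    (store m d w.reverse r c) rfl

theorem runsIn_pour_right_main (w m d l c : List Bool) :
    RunsIn (pour .right .main) (2 * w.length + 1) (store m d l w.reverse c)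
      (store (w ++ m) d l [] c) := by
  simpa using runsIn_pour (x := .right) (y := .main) (by decide) w.reverse
    (store m d l w.reverse c) rfl

theorem runsIn_pour_left_dump (w m d r c : List Bool) :
    RunsIn (pour .left .dump) (2 * w.length + 1) (store m d w.reverse r c)
      (store m (w ++ d) [] r c) := by
  simpa using runsIn_pour (x := .left) (y := .dump) (by decide) w.reverse
    (store m d w.reverse r c) rfl

theorem runsIn_dropTree (t : Tree) (m d : List Bool) :
    RunsIn dropTree (7 * t.word.length + 3) (idle (t.word ++ m) d) (idle m d) := by
  refine (RunsIn.seq (runsIn_take_main_left t m d [] []) (runsIn_discard _ m d [] [])).mono ?_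
  simp; omega

/-- Exchange the two topmost trees. -/
def swapTrees : Prog :=
  .seq (take .main .left) (.seq (take .main .right) (.seq (pour .left .main) (pour .right .main)))

theorem runsIn_swapTrees (t u : Tree) (m d : List Bool) :
    RunsIn swapTrees (7 * t.word.length + 7 * u.word.length + 6)
      (idle (t.word ++ (u.word ++ m)) d) (idle (u.word ++ (t.word ++ m)) d) := by
  have h₁ := runsIn_take_main_left t (u.word ++ m) d [] []
  have h₂ := runsIn_take_main_right u m d t.word.reverse []
  have h₃ := runsIn_pour_left_main t.word m d u.word.reverse []
  have h₄ := runsIn_pour_right_main u.word (t.word ++ m) d [] []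
  rw [List.append_nil] at h₁ h₂
  exact (h₁.seq (h₂.seq (h₃.seq h₄))).mono (by omega)

/-- Duplicate the topmost tree: it is moved to `left`, poured on `main` and `right` at the same
time, and the second copy is then brought back through `left`, because one move would reverse it. -/
def dupTree : Prog :=
  .seq (take .main .left)
    (.seq (.drain .left (.seq (.push .main true) (.push .right true))
      (.seq (.push .main false) (.push .right false)))
      (.seq (pour .right .left) (pour .left .main)))

theorem runsIn_fork (w m d r c : List Bool) :
    RunsIn (.drain .left (.seq (.push .main true) (.push .right true))
      (.seq (.push .main false) (.push .right false))) (3 * w.length + 1)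
      (store m d w r c) (store (w.reverse ++ m) d [] (w.reverse ++ r) c) := by
  induction w generalizing m r with
  | nil => exact ⟨1, le_rfl, .drain_nil rfl⟩
  | cons a w ih =>
    obtain ⟨k, hk, h⟩ := ih (a :: m) (a :: r)
    refine ⟨1 + (1 + 1) + k, by simp; omega, ?_⟩
    cases a
    · exact .drain_false rfl ((Runs.push _ _ _).seq (.push _ _ _)) (by simpa using h)
    · exact .drain_true rfl ((Runs.push _ _ _).seq (.push _ _ _)) (by simpa using h)

theorem runsIn_dupTree (t : Tree) (m d : List Bool) :
    RunsIn dupTree (12 * t.word.length + 5)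
      (idle (t.word ++ m) d) (idle (t.word ++ (t.word ++ m)) d) := by
  have h₁ := runsIn_take_main_left t m d [] []
  have h₂ := runsIn_fork t.word.reverse m d [] []
  have h₃ := runsIn_pour (x := .right) (y := .left) (by decide) t.word
    (store (t.word ++ m) d [] t.word []) rfl
  have h₄ := runsIn_pour_left_main t.word (t.word ++ m) d [] []
  simp only [List.append_nil, List.reverse_reverse, update_store_right, update_store_left,
    store_left] at h₁ h₂ h₃
  exact (h₁.seq (h₂.seq (h₃.seq h₄))).mono (by simp; omega)

/-- Move the topmost tree of `main` to `dump`. -/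
def toDump : Prog := .seq (take .main .left) (pour .left .dump)

theorem runsIn_toDump (t : Tree) (m d : List Bool) :
    RunsIn toDump (7 * t.word.length + 3) (idle (t.word ++ m) d) (idle m (t.word ++ d)) := by
  have h := runsIn_take_main_left t m d [] []
  rw [List.append_nil] at h
  exact (h.seq (runsIn_pour_left_dump t.word m d [] [])).mono (by omega)

/-- Move the topmost tree of `dump` to `main`. -/
def fromDump : Prog := .seq (take .dump .left) (pour .left .main)

theorem runsIn_fromDump (t : Tree) (m d : List Bool) :
    RunsIn fromDump (7 * t.word.length + 3) (idle m (t.word ++ d)) (idle (t.word ++ m) d) := by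
  have h := runsIn_take_dump_left t m d [] []
  rw [List.append_nil] at h
  exact (h.seq (runsIn_pour_left_main t.word m d [] [])).mono (by omega)

/-- Push a word, its last letter first. -/
def pushWord : List Bool → Prog
  | [] => .skip
  | x :: w => .seq (pushWord w) (.push .main x)

theorem runsIn_pushWord (w m d : List Bool) :
    RunsIn (pushWord w) (w.length + 1) (idle m d) (idle (w ++ m) d) := by
  induction w with
  | nil => exact RunsIn.skip _
  | cons x w ih => simpa [pushWord] using ih.seq (.push .main x _)

/-! ### Polynomial-time functions -/

/-- A representation of the elements of a type by trees. Injectivity is not demanded: the theorems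
state which code a program produces. -/
class Code (α : Type) where
  code : α → Tree

open Code (code)

instance : Code Unit := ⟨fun _ => .leaf⟩

instance : Code Bool := ⟨fun b => if b then .node .leaf .leaf else .leaf⟩

instance {α β : Type} [Code α] [Code β] : Code (α × β) := ⟨fun p => .node (code p.1) (code p.2)⟩

/-- A list is coded by a right comb with the codes of its elements. -/
def codeList {α : Type} [Code α] : List α → Tree
  | [] => .leaf
  | a :: l => .node (code a) (codeList l)

instance {α : Type} [Code α] : Code (List α) := ⟨codeList⟩

/-- Numbers are coded in unary. -/
instance : Code ℕ := ⟨fun n => code (List.replicate n ())⟩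

section Word

variable {α β : Type} [Code α] [Code β] (m : List Bool)

theorem word_pair (a : α) (b : β) : (code (a, b)).word ++ m =
    true :: ((code a).word ++ ((code b).word ++ m)) := by simp [code, Tree.word]

theorem word_nil : (code ([] : List α)).word ++ m = false :: m := rfl

theorem word_cons (a : α) (l : List α) : (code (a :: l)).word ++ m =
    true :: ((code a).word ++ ((code l).word ++ m)) := by simp [code, codeList, Tree.word]

theorem word_false : (code false).word ++ m = false :: m := rfl

theorem word_true : (code true).word ++ m = true :: false :: false :: m := rfl

end Word

namespace RunsIn

variable {p q : Prog} {b b' : ℕ} {s : Store} {m d : List Bool}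

theorem cond_main_true (h : RunsIn p b (idle m d) s) :
    RunsIn (.cond .main p q) (1 + b) (idle (true :: m) d) s :=
  cond_true rfl (by simpa using h)

theorem cond_main_false (h : RunsIn q b (idle m d) s) :
    RunsIn (.cond .main p q) (1 + b) (idle (false :: m) d) s :=
  cond_false rfl (by simpa using h)

theorem push_main (x : Bool) (m d : List Bool) :
    RunsIn (.push .main x) 1 (idle m d) (idle (x :: m) d) := by
  simpa using push .main x (idle m d)

theorem loop_dump_true (h : RunsIn p b (idle m d) s) {s' : Store}
    (h' : RunsIn (.loop .dump p) b' s s') :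
    RunsIn (.loop .dump p) (1 + b + b') (idle m (true :: d)) s' :=
  loop_step rfl (by simpa using h) h'

theorem loop_dump_false : RunsIn (.loop .dump p) 1 (idle m (false :: d)) (idle m d) := by
  simpa using loop_exit (r := .dump) (p := p) (s := idle m (false :: d)) (by simp)

end RunsIn

/-- The length of the code of an element. -/
def size {α : Type} [Code α] (a : α) : ℕ := (code a).word.length

section Size

variable {α β : Type} [Code α] [Code β]

@[simp] theorem size_pair (a : α) (b : β) : size (a, b) = 1 + size a + size b := by
  simp only [size, code, Tree.word, List.length_cons, List.length_append]; omega

@[simp] theorem size_unit (a : Unit) : size a = 1 := rfl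

@[simp] theorem size_nil : size ([] : List α) = 1 := rfl

@[simp] theorem size_cons (a : α) (l : List α) : size (a :: l) = 1 + size a + size l := by
  simp only [size, code, codeList, Tree.word, List.length_cons, List.length_append]; omega

@[simp] theorem size_nat (n : ℕ) : size n = 2 * n + 1 := by
  change size (List.replicate n ()) = _
  induction n with
  | zero => rfl
  | succ n ih => rw [List.replicate_succ, size_cons, ih, size_unit]; omega

theorem length_le_size (l : List α) : l.length ≤ size l := by
  induction l with
  | nil => simp
  | cons a l ih => simp; omega

theorem size_le_of_mem {a : α} {l : List α} (h : a ∈ l) : size a ≤ size l := by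
  induction l with
  | nil => simp at h
  | cons b l ih =>
    rcases List.mem_cons.mp h with rfl | h
    · simp; omega
    · have := ih h; simp; omega

end Size

theorem eval_mono (q : Polynomial ℕ) {m n : ℕ} (h : m ≤ n) : q.eval m ≤ q.eval n := by
  induction q using Polynomial.induction_on' with
  | add p q hp hq => simpa using add_le_add hp hq
  | monomial k a => simpa using Nat.mul_le_mul_left a (Nat.pow_le_pow_left h k)

/-- A function is `PolyTime` if a stack program replaces the code of each argument by the code of
the value in a number of steps that is bounded by a polynomial in the size of the argument. What
lies below on the stacks `main` and `dump` is arbitrary and stays there, so that programs can be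
used inside each other. -/
@[fun_prop]
def PolyTime {α β : Type} [Code α] [Code β] (f : α → β) : Prop :=
  ∃ (p : Prog) (q : Polynomial ℕ), ∀ (a : α) (m d : List Bool),
    RunsIn p (q.eval (size a)) (idle ((code a).word ++ m) d) (idle ((code (f a)).word ++ m) d)

namespace PolyTime

variable {α β γ δ : Type} [Code α] [Code β] [Code γ] [Code δ]

theorem size_le {f : α → β} (h : PolyTime f) :
    ∃ q : Polynomial ℕ, ∀ a, size (f a) ≤ q.eval (size a) := by
  obtain ⟨p, q, h⟩ := h
  refine ⟨q + .X, fun a => ?_⟩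
  obtain ⟨k, hk, h⟩ := h a [] []
  have := h.length_le .main
  simp only [store_main, List.append_nil] at this
  simp only [size, Polynomial.eval_add, Polynomial.eval_X] at hk ⊢
  omega

/-- A function with the same codes of values is computed by the same program. -/
theorem of_code_eq {f : α → β} {g : α → γ} (h : PolyTime f) (hg : ∀ a, code (g a) = code (f a)) :
    PolyTime g := by
  obtain ⟨p, q, h⟩ := h
  exact ⟨p, q, fun a m d => by rw [hg]; exact h a m d⟩

@[fun_prop]
theorem id : PolyTime fun a : α => a := ⟨.skip, 1, fun _ _ _ => by simpa using RunsIn.skip _⟩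

@[fun_prop]
theorem comp {g : β → γ} {f : α → β} (hg : PolyTime g) (hf : PolyTime f) :
    PolyTime fun a => g (f a) := by
  obtain ⟨r, hr⟩ := hf.size_le
  obtain ⟨pg, qg, hg⟩ := hg
  obtain ⟨pf, qf, hf⟩ := hf
  refine ⟨.seq pf pg, qf + qg.comp r, fun a m d => ((hf a m d).seq (hg (f a) m d)).mono ?_⟩
  simpa using eval_mono qg (hr a)

@[fun_prop]
theorem const (b : β) : PolyTime fun _ : α => b := by
  refine ⟨.seq dropTree (pushWord (code b).word), 7 * .X + 3 + (size b + 1 : ℕ), fun a m d => ?_⟩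
  refine ((runsIn_dropTree _ m d).seq (runsIn_pushWord _ m d)).mono ?_
  simp [size]

@[fun_prop]
theorem pair {f : α → β} {g : α → γ} (hf : PolyTime f) (hg : PolyTime g) :
    PolyTime fun a => (f a, g a) := by
  obtain ⟨r, hr⟩ := hf.size_le
  obtain ⟨r', hr'⟩ := hg.size_le
  obtain ⟨pf, qf, hf⟩ := hf
  obtain ⟨pg, qg, hg⟩ := hg
  refine ⟨.seq dupTree (.seq pf (.seq swapTrees (.seq pg (.seq swapTrees (.push .main true))))),
    12 * .X + 5 + (qf + (7 * r + 7 * .X + 6 + (qg + (7 * r' + 7 * r + 6 + 1)))), fun a m d => ?_⟩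
  have h := (runsIn_dupTree (code a) m d).seq ((hf a _ d).seq ((runsIn_swapTrees _ _ m d).seq
    ((hg a _ d).seq ((runsIn_swapTrees _ _ m d).seq (.push_main true _ d)))))
  rw [← word_pair] at h
  refine h.mono ?_
  have h₁ := hr a
  have h₂ := hr' a
  simp [size] at h₁ h₂ ⊢
  omega

@[fun_prop]
theorem fst {f : α → β × γ} (hf : PolyTime f) : PolyTime fun a => (f a).1 := by
  refine comp (g := Prod.fst) ?_ hf
  refine ⟨.cond .main (.seq swapTrees dropTree) .skip, 14 * .X + 10, fun ⟨a, b⟩ m d => ?_⟩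
  rw [word_pair]
  refine (RunsIn.cond_main_true ((runsIn_swapTrees _ _ m d).seq (runsIn_dropTree _ _ d))).mono ?_
  simp
  simp [size]; omega

@[fun_prop]
theorem snd {f : α → β × γ} (hf : PolyTime f) : PolyTime fun a => (f a).2 := by
  refine comp (g := Prod.snd) ?_ hf
  refine ⟨.cond .main dropTree .skip, 7 * .X + 4, fun ⟨a, b⟩ m d => ?_⟩
  rw [word_pair]
  refine (RunsIn.cond_main_true (runsIn_dropTree _ _ d)).mono ?_
  simp
  simp [size]; omega

@[fun_prop]
theorem cond {c : α → Bool} {f g : α → β} (hc : PolyTime c) (hf : PolyTime f) (hg : PolyTime g) :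
    PolyTime fun a => bif c a then f a else g a := by
  obtain ⟨pc, qc, hc⟩ := hc
  obtain ⟨pf, qf, hf⟩ := hf
  obtain ⟨pg, qg, hg⟩ := hg
  refine ⟨.seq dupTree (.seq pc (.cond .main
      (.seq (.cond .main .skip .skip) (.seq (.cond .main .skip .skip) pf)) pg)),
    12 * .X + 5 + (qc + (5 + qf + qg)), fun a m d => ?_⟩
  beta_reduce
  refine ((runsIn_dupTree (code a) m d).seq ((hc a _ d).seq (b' := 5 + qf.eval (size a) +
    qg.eval (size a)) ?_)).mono (by simp [size])
  cases c a
  · rw [word_false]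
    refine (RunsIn.cond_main_false (hg a m d)).mono ?_
    omega
  · rw [word_true]
    refine (RunsIn.cond_main_true ((RunsIn.cond_main_false (.skip _)).seq
      ((RunsIn.cond_main_false (.skip _)).seq (hf a m d)))).mono ?_
    omega

/-! ### Lists and folds -/

@[fun_prop]
theorem cons {f : α → β} {l : α → List β} (hf : PolyTime f) (hl : PolyTime l) :
    PolyTime fun a => f a :: l a := (hf.pair hl).of_code_eq fun _ => rfl

@[fun_prop]
theorem tail {l : α → List β} (hl : PolyTime l) : PolyTime fun a => (l a).tail := by
  refine comp (g := List.tail) ?_ hl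
  refine ⟨.cond .main dropTree (.push .main false), 7 * .X + 4, fun l m d => ?_⟩
  rcases l with _ | ⟨a, l⟩
  · rw [List.tail_nil, word_nil]
    exact (RunsIn.cond_main_false (.push_main false m d)).mono (by simp)
  · rw [List.tail_cons, word_cons]
    refine (RunsIn.cond_main_true (runsIn_dropTree _ _ d)).mono ?_
    simp
    simp [size]; omega

@[fun_prop]
theorem isEmpty {l : α → List β} (hl : PolyTime l) : PolyTime fun a => (l a).isEmpty := by
  refine comp (g := List.isEmpty) ?_ hl
  refine ⟨.cond .main (.seq dropTree (.seq dropTree (pushWord (code false).word)))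
    (pushWord (code true).word), 14 * .X + 10, fun l m d => ?_⟩
  rcases l with _ | ⟨a, l⟩
  · rw [List.isEmpty_nil, word_nil]
    refine (RunsIn.cond_main_false (runsIn_pushWord _ m d)).mono ?_
    simp [code, Tree.word]
  · rw [List.isEmpty_cons, word_cons]
    refine (RunsIn.cond_main_true ((runsIn_dropTree _ _ d).seq ((runsIn_dropTree _ _ d).seq
      (runsIn_pushWord _ m d)))).mono ?_
    simp
    simp [size, Tree.word, show code false = Tree.leaf from rfl]; omega

@[fun_prop]
theorem headD {l : α → List β} (hl : PolyTime l) (b : β) : PolyTime fun a => (l a).headD b := by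
  refine comp (g := fun l => l.headD b) ?_ hl
  refine ⟨.cond .main (.seq swapTrees dropTree) (pushWord (code b).word),
    14 * .X + 10 + (size b + 1 : ℕ), fun l m d => ?_⟩
  rcases l with _ | ⟨a, l⟩
  · rw [word_nil]
    refine (RunsIn.cond_main_false (runsIn_pushWord _ m d)).mono ?_
    simp [size]
  · rw [word_cons]
    refine (RunsIn.cond_main_true ((runsIn_swapTrees _ _ _ d).seq (runsIn_dropTree _ _ d))).mono ?_
    simp
    simp [size]; omega

/-- The program of a fold: the list is on `dump`, its elements are brought to `main` one by one and
combined with the accumulator there. -/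
theorem runsIn_foldLoop {g : α → β → β} {p : Prog} {q : Polynomial ℕ}
    (hg : ∀ (x : α × β) (m d : List Bool),
      RunsIn p (q.eval (size x)) (idle ((code x).word ++ m) d)
        (idle ((code (g x.1 x.2)).word ++ m) d))
    (S : ℕ) (m d : List Bool) (l : List α) (b : β)
    (hS : ∀ l₁, l₁ <+: l → size (l₁.foldl (fun b a => g a b) b) ≤ S) (hl : ∀ a ∈ l, size a ≤ S) :
    RunsIn (.loop .dump (.seq fromDump (.seq (.push .main true) p)))
      (l.length * (7 * S + 5 + q.eval (1 + S + S)) + 1)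
      (idle ((code b).word ++ m) ((code l).word ++ d))
      (idle ((code (l.foldl (fun b a => g a b) b)).word ++ m) d) := by
  induction l generalizing b with
  | nil =>
    rw [word_nil]
    exact RunsIn.loop_dump_false.mono (by simp)
  | cons a l ih =>
    have h := ih (g a b) (fun l₁ h => hS (a :: l₁) (by simpa using h))
      (fun a' h => hl a' (List.mem_cons_of_mem _ h))
    have h₁ := RunsIn.push_main true ((code a).word ++ ((code b).word ++ m)) ((code l).word ++ d)
    rw [← word_pair] at h₁
    rw [word_cons]
    refine (RunsIn.loop_dump_true ((runsIn_fromDump _ _ _).seq (h₁.seq (hg (a, b) m _))) h).mono ?_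
    have ha : size a ≤ S := hl a List.mem_cons_self
    have hb : size b ≤ S := hS [] (by simp)
    have hq : q.eval (size (a, b)) ≤ q.eval (1 + S + S) := eval_mono q (by simp; omega)
    change (code a).word.length ≤ S at ha
    simp only [List.length_cons, Nat.add_mul]
    omega

/-- Folds without access to the context, under a bound on the size of all intermediate values. -/
theorem foldl_aux {l : γ → List α} {init : γ → β} {g : α → β → β}
    (h : PolyTime fun x => (l x, init x)) (hg : PolyTime fun p : α × β => g p.1 p.2)
    (hb : ∃ Q : Polynomial ℕ, ∀ x l₁, l₁ <+: l x →
      size (l₁.foldl (fun b a => g a b) (init x)) ≤ Q.eval (size x)) :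
    PolyTime fun x => (l x).foldl (fun b a => g a b) (init x) := by
  obtain ⟨r, hr⟩ := h.size_le
  obtain ⟨p, q, h⟩ := h
  obtain ⟨pg, qg, hg⟩ := hg
  obtain ⟨Q, hQ⟩ := hb
  -- `r` bounds the list, its length and the initial value; `r + Q` bounds all that occurs in the
  -- loop.
  refine ⟨.seq p (.cond .main (.seq toDump
    (.loop .dump (.seq fromDump (.seq (.push .main true) pg)))) .skip),
    q + (1 + (7 * r + 3 + (r * (7 * (r + Q) + 5 + qg.comp (1 + (r + Q) + (r + Q))) + 1))),
    fun x m d => ?_⟩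
  have hx := hr x
  simp only [size_pair] at hx
  have h₁ := runsIn_toDump (code (l x)) ((code (init x)).word ++ m) d
  have h₂ := runsIn_foldLoop hg (r.eval (size x) + Q.eval (size x)) m d (l x) (init x)
    (fun l₁ h => (hQ x l₁ h).trans (by omega)) (fun a ha => by have := size_le_of_mem ha; omega)
  have h₃ := h x m d
  rw [word_pair] at h₃
  refine (h₃.seq (.cond_main_true (h₁.seq h₂))).mono ?_
  simp only [Polynomial.eval_add, Polynomial.eval_mul, Polynomial.eval_comp, Polynomial.eval_one,
    Polynomial.eval_ofNat]
  have := length_le_size (l x)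
  have : (code (l x)).word.length = size (l x) := rfl
  gcongr <;> omega

/-- Closure under folds. The step may use the context `x`, which is carried along with the
accumulator, and may enlarge the accumulator by at most a polynomial in the size of `x`. This
excludes exponential growth by repeated doubling. -/
theorem foldl {l : γ → List α} {init : γ → β} {g : γ → β → α → β} (hl : PolyTime l)
    (hi : PolyTime init) (hg : PolyTime fun p : γ × β × α => g p.1 p.2.1 p.2.2)
    (hb : ∃ Q : Polynomial ℕ, ∀ x, ∀ a ∈ l x, ∀ b, size (g x b a) ≤ size b + Q.eval (size x)) :
    PolyTime fun x => (l x).foldl (g x) (init x) := by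
  have key : ∀ x (l₁ : List α) (b : β), l₁.foldl (fun (b : β × γ) a => (g b.2 b.1 a, b.2)) (b, x) =
      (l₁.foldl (g x) b, x) := by
    intro x l₁
    induction l₁ with
    | nil => intro b; rfl
    | cons a l₁ ih => intro b; exact ih _
  obtain ⟨Q, hQ⟩ := hb
  obtain ⟨r, hr⟩ := hl.size_le
  obtain ⟨r', hr'⟩ := hi.size_le
  have bound : ∀ x (l₁ : List α) (b : β), (∀ a ∈ l₁, a ∈ l x) →
      size (l₁.foldl (g x) b) ≤ size b + l₁.length * Q.eval (size x) := by
    intro x l₁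
    induction l₁ with
    | nil => intro b _; simp
    | cons a l₁ ih =>
      intro b h
      have h₁ := ih (g x b a) fun a h' => h a (List.mem_cons_of_mem _ h')
      have h₂ := hQ x a (h a List.mem_cons_self) b
      simp only [List.foldl_cons, List.length_cons, Nat.add_mul]
      omega
  have := foldl_aux (l := l) (init := fun x => (init x, x))
    (g := fun a (b : β × γ) => (g b.2 b.1 a, b.2)) (by fun_prop)
    (by
      refine pair (comp (f := fun p : α × β × γ => (p.2.2, p.2.1, p.1)) hg ?_) ?_ <;> fun_prop)
    ⟨1 + (r' + r * Q) + .X, fun x l₁ h => by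
      rw [key]
      have h₁ := bound x l₁ (init x) fun a h' => h.subset h'
      have h₂ : l₁.length * Q.eval (size x) ≤ r.eval (size x) * Q.eval (size x) := by
        gcongr
        exact h.length_le.trans ((length_le_size _).trans (hr x))
      have h₃ := hr' x
      simp only [size_pair, Polynomial.eval_add, Polynomial.eval_one, Polynomial.eval_X,
        Polynomial.eval_mul]
      omega⟩
  exact this.fst.of_code_eq fun x => by rw [key]

/-! ### Unary numbers -/

/-- A natural number has the code of a list of that length. -/
@[fun_prop]
theorem replicate_unit {n : α → ℕ} (hn : PolyTime n) :
    PolyTime fun a => List.replicate (n a) () := hn.of_code_eq fun _ => rfl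

@[fun_prop]
theorem succ {n : α → ℕ} (hn : PolyTime n) : PolyTime fun a => n a + 1 :=
  ((const ()).cons hn.replicate_unit).of_code_eq fun _ => rfl

@[fun_prop]
theorem pred {n : α → ℕ} (hn : PolyTime n) : PolyTime fun a => n a - 1 :=
  hn.replicate_unit.tail.of_code_eq fun a => by rw [List.tail_replicate]; rfl

theorem iterate {n : α → ℕ} {init : α → β} {g : α → β → β} (hn : PolyTime n) (hi : PolyTime init)
    (hg : PolyTime fun p : α × β => g p.1 p.2)
    (hb : ∃ Q : Polynomial ℕ, ∀ x b, size (g x b) ≤ size b + Q.eval (size x)) :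
    PolyTime fun x => (g x)^[n x] (init x) := by
  obtain ⟨Q, hQ⟩ := hb
  have h := foldl (g := fun x b (_ : Unit) => g x b) hn.replicate_unit hi
    (comp (f := fun p : α × β × Unit => (p.1, p.2.1)) hg (by fun_prop))
    ⟨Q, fun x _ _ b => hQ x b⟩
  simpa [List.foldl_const] using h

@[fun_prop]
theorem add {m n : α → ℕ} (hm : PolyTime m) (hn : PolyTime n) : PolyTime fun a => m a + n a := by
  have h := iterate (g := fun _ k => k + 1) hn hm (by fun_prop) ⟨2, fun _ b => by simp; omega⟩
  simpa using h

@[fun_prop]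
theorem sub {m n : α → ℕ} (hm : PolyTime m) (hn : PolyTime n) : PolyTime fun a => m a - n a := by
  have h := iterate (g := fun _ k => k - 1) hn hm (by fun_prop) ⟨0, fun _ b => by simp⟩
  have e : ∀ m n : ℕ, (fun k => k - 1)^[n] m = m - n := by
    intro m n
    induction n with
    | zero => rfl
    | succ n ih => rw [iterate_succ_apply', ih]; omega
  simpa [e] using h

@[fun_prop]
theorem min {m n : α → ℕ} (hm : PolyTime m) (hn : PolyTime n) :
    PolyTime fun a => Min.min (m a) (n a) := by
  have : (fun a => Min.min (m a) (n a)) = fun a => m a - (m a - n a) := by funext a; omega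
  rw [this]; fun_prop

@[fun_prop]
theorem decide_le {m n : α → ℕ} (hm : PolyTime m) (hn : PolyTime n) :
    PolyTime fun a => decide (m a ≤ n a) := by
  have : (fun a => decide (m a ≤ n a)) = fun a => (List.replicate (m a - n a) ()).isEmpty := by
    funext a
    rw [Bool.eq_iff_iff]
    simp [Nat.sub_eq_zero_iff_le]
  rw [this]; fun_prop

@[fun_prop]
theorem decide_lt {m n : α → ℕ} (hm : PolyTime m) (hn : PolyTime n) :
    PolyTime fun a => decide (m a < n a) := decide_le hm.succ hn

/-! ### More functions on lists -/

@[fun_prop]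
theorem length {l : α → List β} (hl : PolyTime l) : PolyTime fun a => (l a).length := by
  have h := foldl (g := fun _ (n : ℕ) _ => n + 1) hl (const 0) (by fun_prop)
    ⟨2, fun _ _ _ b => by simp; omega⟩
  simpa [List.foldl_const] using h

@[fun_prop]
theorem reverse {l : α → List β} (hl : PolyTime l) : PolyTime fun a => (l a).reverse := by
  have h := foldl (g := fun _ (l' : List β) b => b :: l') hl (const []) (by fun_prop) (by
    obtain ⟨q, hq⟩ := hl.size_le
    refine ⟨1 + q, fun x a ha b => ?_⟩
    have := size_le_of_mem ha
    have := hq x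
    simp; omega)
  simpa using h

theorem foldr {l : γ → List α} {init : γ → β} {g : γ → α → β → β} (hl : PolyTime l)
    (hi : PolyTime init) (hg : PolyTime fun p : γ × α × β => g p.1 p.2.1 p.2.2)
    (hb : ∃ Q : Polynomial ℕ, ∀ x, ∀ a ∈ l x, ∀ b, size (g x a b) ≤ size b + Q.eval (size x)) :
    PolyTime fun x => (l x).foldr (g x) (init x) := by
  obtain ⟨Q, hQ⟩ := hb
  have h := foldl (g := fun x b a => g x a b) hl.reverse hi
    (comp (f := fun p : γ × β × α => (p.1, p.2.2, p.2.1)) hg (by fun_prop))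
    ⟨Q, fun x a ha b => hQ x a (List.mem_reverse.mp ha) b⟩
  simpa [List.foldl_reverse] using h

@[fun_prop]
theorem map {l : γ → List α} {g : γ → α → β} (hl : PolyTime l)
    (hg : PolyTime fun p : γ × α => g p.1 p.2) : PolyTime fun x => (l x).map (g x) := by
  have h := foldr (g := fun x a l' => g x a :: l') hl (const [])
    (comp (f := fun p : γ × α × List β => (p.1, p.2.1)) hg (by fun_prop) |>.cons (by fun_prop)) (by
    obtain ⟨q, hq⟩ := hl.size_le
    obtain ⟨r, hr⟩ := hg.size_le
    refine ⟨1 + r.comp (1 + .X + q), fun x a ha b => ?_⟩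
    have h₁ := (size_le_of_mem ha).trans (hq x)
    have h₂ := (hr (x, a)).trans (eval_mono r (n := 1 + size x + q.eval (size x)) (by simp; omega))
    simp at h₂ ⊢
    omega)
  simpa only [← List.map_eq_foldr] using h

@[fun_prop]
theorem sum {l : α → List ℕ} (hl : PolyTime l) : PolyTime fun a => (l a).sum :=
  foldr (g := fun _ m n => m + n) hl (const 0) (by fun_prop) (by
    obtain ⟨q, hq⟩ := hl.size_le
    refine ⟨q, fun x a ha b => ?_⟩
    have := (size_le_of_mem ha).trans (hq x)
    simp at this ⊢
    omega)

@[fun_prop]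
theorem countP {l : γ → List α} {p : γ → α → Bool} (hl : PolyTime l)
    (hp : PolyTime fun x : γ × α => p x.1 x.2) : PolyTime fun x => (l x).countP (p x) := by
  have e : ∀ (q : α → Bool) (l : List α),
      l.countP q = (l.map fun a => bif q a then 1 else 0).sum := by
    intro q l
    induction l with
    | nil => rfl
    | cons a l ih => cases h : q a <;> simp [h, ih, Nat.add_comm]
  simp only [e]
  fun_prop

omit [Code α] in
theorem list_iterate_tail (l : List α) (n : ℕ) : List.tail^[n] l = l.drop n := by
  induction n with
  | zero => rfl
  | succ n ih => rw [iterate_succ_apply', ih, List.tail_drop]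

@[fun_prop]
theorem getD {l : α → List β} {n : α → ℕ} (hl : PolyTime l) (hn : PolyTime n) (b : β) :
    PolyTime fun a => (l a).getD (n a) b := by
  have h := iterate (g := fun _ (l : List β) => l.tail) hn hl (by fun_prop)
    ⟨0, fun _ l => by cases l <;> simp⟩
  have h' := h.headD b
  simp only [list_iterate_tail] at h'
  simpa [List.headD_eq_head?_getD, List.head?_drop, List.getD_eq_getElem?_getD] using h'

/-- The step of the iteration conses the length of the list; the minimum with `n`, which changes
nothing on the way, bounds its growth on arbitrary lists. -/
@[fun_prop]
theorem range {n : α → ℕ} (hn : PolyTime n) : PolyTime fun a => List.range (n a) := by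
  have e : ∀ n k : ℕ, k ≤ n →
      (fun l : List ℕ => Min.min l.length n :: l)^[k] [] = (List.range k).reverse := by
    intro n k
    induction k with
    | zero => intro _; rfl
    | succ k ih =>
      intro h
      rw [iterate_succ_apply', ih (by omega), List.range_succ]
      simp; omega
  have h := iterate (g := fun a (l : List ℕ) => Min.min l.length (n a) :: l) hn (const [])
    (by fun_prop) (by
      obtain ⟨q, hq⟩ := hn.size_le
      refine ⟨1 + q, fun a l => ?_⟩
      have := hq a
      simp at this ⊢
      omega)
  have h' := h.reverse
  simpa [e] using h'

end PolyTime

/-! ### From stack programs to Turing machines -/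

section Machine

variable {A : Type} [Code A] [DecidableEq A]

/-- Push a word on `main`, its first letter first, before executing a statement. -/
def pushBits {L : Type} : List Bool → TM2.Stmt (Alphabet A) L (Memory A) →
    TM2.Stmt (Alphabet A) L (Memory A)
  | [], q => q
  | x :: w, q => pushBits w (.push (some .main) (fun _ => x) q)

omit [Code A] [DecidableEq A] in
theorem stepAux_pushBits {L : Type} (w : List Bool) (q : TM2.Stmt (Alphabet A) L (Memory A))
    (v : Memory A) (i : List A) (m d : List Bool) :
    TM2.stepAux (pushBits w q) v (contents i (idle m d)) =
      TM2.stepAux q v (contents i (idle (w ++ m) d)) := by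
  induction w generalizing q with
  | nil => rfl
  | cons x w ih =>
    refine (ih _).trans ?_
    have h := update_contents i (idle (w ++ m) d) .main (x :: (w ++ m))
    rw [update_store_main] at h
    exact congrArg (TM2.stepAux q v) h

/-- If the symbol in the memory is in the list, cons its code to the list coded on `main`; then go
to the label `read`. -/
def dispatch {L : Type} (read : L) : List A → TM2.Stmt (Alphabet A) L (Memory A)
  | [] => jump read
  | a :: as => .branch (fun v => decide (v = some (Sum.inl a)))
      (pushBits (true :: (code a).word) (jump read)) (dispatch read as)

theorem stepAux_dispatch {L : Type} (read : L) (a : A) (as : List A) (h : a ∈ as) (i l : List A) :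
    TM2.stepAux (dispatch read as) (some (Sum.inl a)) (contents i (idle (code l).word [])) =
      ⟨some read, none, contents i (idle (code (a :: l)).word [])⟩ := by
  induction as with
  | nil => simp at h
  | cons b as ih =>
    rw [dispatch, TM2.stepAux]
    by_cases hb : a = b
    · subst hb
      simp only [decide_true, cond_true]
      rw [stepAux_pushBits]
      have := word_cons [] a l
      simp only [List.append_nil] at this
      rw [this]; rfl
    · have h' : a ∈ as := by simpa [hb] using h
      have : (some (Sum.inl a) : Memory A) ≠ some (Sum.inl b) := by simpa using hb
      simp only [this, decide_false, cond_false]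
      exact ih h'

/-- The labels of the machine for a program: `none` is the start, `some true` reads the input, `some
false` halts. -/
abbrev HostLabel (p : Prog) : Type := Option Bool ⊕ Label p

/-- The machine for a program: it turns the input into the code of a list, which comes out reversed,
and runs the program on it. -/
noncomputable def host [Fintype A] (p : Prog) :
    HostLabel p → TM2.Stmt (Alphabet A) (HostLabel p) (Memory A)
  | Sum.inl none => .push (some .main) (fun _ => false) (jump (Sum.inl (some true)))
  | Sum.inl (some true) => .pop none (fun _ (o : Option A) => o.map Sum.inl)
      (.branch Option.isNone (jump (Sum.inr (entry p)))
        (dispatch (Sum.inl (some true)) (Finset.univ : Finset A).toList))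
  | Sum.inl (some false) => .halt
  | Sum.inr l => stmt p Sum.inr (Sum.inl (some false)) l

variable [Fintype A] (p : Prog)

theorem reaches_read (w l : List A) :
    Reaches (host p) (w.length + 1)
      ⟨some (Sum.inl (some true)), none, contents w (idle (code l).word [])⟩
      ⟨some (Sum.inr (entry p)), none, contents [] (idle (code (w.reverse ++ l)).word [])⟩ := by
  induction w generalizing l with
  | nil =>
    refine Reaches.of_step ?_
    have : update (contents ([] : List A) (idle (code l).word [])) none ([] : List A) =
        contents [] (idle (code l).word []) := update_eq_self _ _
    exact congrArg (fun S => (⟨some (Sum.inr (entry p)), none, S⟩ : TM2.Cfg (Alphabet A) _ _)) this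
  | cons a w ih =>
    rw [List.length_cons, Nat.add_comm (w.length + 1) 1]
    refine Reaches.trans (Reaches.of_step ?_) (by simpa using ih (a :: l))
    have : update (contents (a :: w) (idle (code l).word [])) none w =
        contents w (idle (code l).word []) := by
      funext k
      rcases k with _ | r <;> rfl
    have h := stepAux_dispatch (Sum.inl (some true) : HostLabel p) a Finset.univ.toList
      (by simp) w l
    rw [← this] at h
    exact h

/-- The bundled machine for a program. The answer appears on the stack `main`. -/
noncomputable def hostMachine : FinTM2 where
  K := Option Reg
  k₀ := none
  k₁ := some .main
  Γ := Alphabet A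
  Λ := HostLabel p
  main := Sum.inl none
  σ := Memory A
  initialState := none
  Γk₀Fin := inferInstanceAs (Fintype A)
  m := host p

theorem reaches_host {w : List A} {b : Bool} {k : ℕ}
    (h : Runs p k (idle (code w.reverse).word []) (idle [b] [])) :
    (flip bind (hostMachine (A := A) p).step)^[1 + (w.length + 1) + k + 1]
      (some (initList (hostMachine p) w)) = some (haltList (hostMachine (A := A) p) [b]) := by
  have h₀ : Reaches (host p) 1 ⟨some (Sum.inl none), none, contents w (idle [] [])⟩
      ⟨some (Sum.inl (some true)), none, contents w (idle [false] [])⟩ := by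
    refine Reaches.of_step ?_
    have := update_contents w (idle [] []) .main [false]
    rw [update_store_main] at this
    rw [← this]; rfl
  have h₁ := reaches_read p w []
  have h₂ := h.reaches (M := host (A := A) p) [] Sum.inr (Sum.inl (some false)) fun _ => rfl
  have h₃ : Reaches (host p) 1 ⟨some (Sum.inl (some false)), none, contents [] (idle [b] [])⟩
      ⟨none, none, contents ([] : List A) (idle [b] [])⟩ := Reaches.of_step rfl
  rw [List.append_nil] at h₁
  have h₄ := ((h₀.trans h₁).trans h₂).trans h₃
  have e₀ : initList (hostMachine p) w = ⟨some (Sum.inl none), none, contents w (idle [] [])⟩ := by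
    refine congrArg (fun S => (⟨some (Sum.inl none), none, S⟩ : TM2.Cfg (Alphabet A) _ _)) ?_
    funext k
    rcases k with _ | r
    · rfl
    · cases r <;> rfl
  have e₁ : haltList (hostMachine (A := A) p) [b] =
      (⟨none, none, contents ([] : List A) (idle [b] [])⟩ : TM2.Cfg (Alphabet A) _ _) := by
    refine congrArg (fun S => (⟨none, none, S⟩ : TM2.Cfg (Alphabet A) _ _)) ?_
    funext k
    rcases k with _ | r
    · rfl
    · cases r <;> rfl
  rw [e₀, e₁]
  exact h₄

end Machine

/-- Replace the code of a truth value by a single bit. -/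
def emitBool : Prog :=
  .cond .main (.seq (.cond .main .skip .skip) (.seq (.cond .main .skip .skip) (.push .main true)))
    (.push .main false)

theorem runsIn_emitBool (b : Bool) : RunsIn emitBool 6 (idle (code b).word []) (idle [b] []) := by
  cases b
  · exact (RunsIn.cond_main_false (.push_main false _ _)).mono (by omega)
  · exact (RunsIn.cond_main_true ((RunsIn.cond_main_false (.skip _)).seq
      ((RunsIn.cond_main_false (.skip _)).seq (.push_main true _ _)))).mono le_rfl

theorem exists_size_list_le (A : Type) [Code A] [Fintype A] :
    ∃ K, ∀ w : List A, size w ≤ K * w.length + 1 := by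
  refine ⟨1 + ∑ a : A, size a, fun w => ?_⟩
  induction w with
  | nil => simp
  | cons a w ih =>
    have := Finset.single_le_sum (f := fun a : A => size a) (fun _ _ => Nat.zero_le _)
      (Finset.mem_univ a)
    simp only [size_cons, List.length_cons, Nat.mul_add] at ih this ⊢
    omega

/-- A decision procedure on words that is `PolyTime` is computable in polynomial time by a Turing
machine. -/
theorem PolyTime.computable {A : Type} [Code A] [Fintype A] [DecidableEq A] {F : List A → Bool}
    (hF : PolyTime F) {α : Type} (e : α → List A) :
    Nonempty (TM2ComputableInPolyTime e Computability.encodeBool fun a => F (e a)) := by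
  obtain ⟨p, q, h⟩ := hF.comp (PolyTime.id (α := List A)).reverse
  obtain ⟨K, hK⟩ := exists_size_list_le A
  have key : ∀ a,
      ∃ k ≤ (Polynomial.X + 9 + q.comp ((K : Polynomial ℕ) * Polynomial.X + 1)).eval (e a).length,
      (flip bind (hostMachine (A := A) (.seq p emitBool)).step)^[k]
        (some (initList (hostMachine (.seq p emitBool)) (e a))) =
        some (haltList (hostMachine (A := A) (.seq p emitBool)) [F (e a)]) := by
    intro a
    have h₁ := h (e a).reverse [] []
    simp only [List.append_nil, List.reverse_reverse] at h₁
    obtain ⟨k, hk, h₂⟩ := h₁.seq (runsIn_emitBool _)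
    refine ⟨_, ?_, reaches_host _ h₂⟩
    have hs := hK (e a).reverse
    rw [List.length_reverse] at hs
    have := eval_mono q hs
    simp
    omega
  exact ⟨{
    tm := hostMachine (.seq p emitBool)
    inputAlphabet := Equiv.refl A
    outputAlphabet := Equiv.refl Bool
    time := Polynomial.X + 9 + q.comp ((K : Polynomial ℕ) * Polynomial.X + 1)
    outputsFun := fun a =>
      { steps := (key a).choose
        evals_in_steps :=
          (congrArg (fun w : List A =>
            (flip bind (hostMachine (A := A) (.seq p emitBool)).step)^[(key a).choose]
              (some (initList (hostMachine (.seq p emitBool)) w))) (List.map_id (e a))).trans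
            (key a).choose_spec.2
        steps_le_m := (key a).choose_spec.1 } }⟩

end StackProgram

namespace JudgmentAggregation

open StackProgram
open StackProgram.Code (code)

/-! ### The algorithm -/

/-- The alphabet as a list. A symbol is coded by its position there. -/
def Symbol.all : List Symbol :=
  [.tick, .bit true, .bit false, .star, .top, .bot, .issue true, .issue false, .aux true,
    .aux false, .conj, .disj, .sep, .bar]

instance : Code Symbol := ⟨fun s => code (Symbol.all.idxOf s)⟩

section Symbols

variable {α β : Type} [Code α] [Code β]

/-- Every function of a symbol is `PolyTime`, by looking up a table. -/
theorem polyTime_symbol (h : Symbol → β) {f : α → Symbol} (hf : PolyTime f) :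
    PolyTime fun a => h (f a) := by
  have h₁ : PolyTime fun a => Symbol.all.idxOf (f a) := hf.of_code_eq fun _ => rfl
  have h₂ := (PolyTime.const (α := α) (Symbol.all.map h)).getD h₁ (h .tick)
  have e : ∀ s, (Symbol.all.map h).getD (Symbol.all.idxOf s) (h .tick) = h s := by
    rintro (_ | (_ | _) | _ | _ | _ | (_ | _) | (_ | _) | _ | _ | _ | _) <;> rfl
  simpa only [e] using h₂

@[fun_prop]
theorem polyTime_not {b : α → Bool} (hb : PolyTime b) : PolyTime fun a => !b a := by
  have : (fun a => !b a) = fun a => bif b a then false else true := by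
    funext a; cases b a <;> rfl
  rw [this]; fun_prop

end Symbols

/-- One step of `splitWords`: the pair consists of the word being read, from right to left, and the
words found already. -/
def splitStep (H : Symbol → Bool) (s : Symbol) (p : List Symbol × List (List Symbol)) :
    List Symbol × List (List Symbol) :=
  bif H s then ([], (s :: p.1) :: p.2) else (s :: p.1, p.2)

/-- Cut a word before each symbol with the property `H`; the first component is the part before the
first such symbol. -/
def splitWords (H : Symbol → Bool) (w : List Symbol) : List Symbol × List (List Symbol) :=
  w.foldr (splitStep H) ([], [])

def isBar : Symbol → Bool | .bar => true | _ => false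
def isSep : Symbol → Bool | .sep => true | _ => false
def isStar : Symbol → Bool | .star => true | _ => false
def isConj : Symbol → Bool | .conj => true | _ => false
def isDisj : Symbol → Bool | .disj => true | _ => false
def isBot : Symbol → Bool | .bot => true | _ => false
def isIssue : Symbol → Bool | .issue _ => true | _ => false
def isBit : Symbol → Bool | .bit _ => true | _ => false

/-- The Boolean version of `IsGateHead`. -/
def isGateStart : Symbol → Bool
  | .tick | .bit _ | .sep | .bar => false
  | _ => true

/-- The truth value that a bit or a literal of an issue carries. -/
def polarity : Symbol → Bool | .bit b => b | .issue b => b | _ => false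

/-- The symbol is the bit `b`. -/
def hasBit (b : Bool) (s : Symbol) : Bool :=
  bif isBit s then (bif b then polarity s else !polarity s) else false

/-- The part of the input between the bar number `k`, counted from zero, and the next one. -/
def field (w : List Symbol) (k : ℕ) : List Symbol := ((splitWords isBar w).2.getD k []).tail

/-- The number of issues. -/
def issueCount (w : List Symbol) : ℕ := (splitWords isBar w).1.length

/-- The index of the root. -/
def rootIndex (w : List Symbol) : ℕ := (field w 0).length

/-- The nodes of the circuit, as words. -/
def gateWords (w : List Symbol) : List (List Symbol) := (splitWords isGateStart (field w 1)).2

/-- The ballots of the profile, as words of bits. -/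
def ballotWords (w : List Symbol) : List (List Symbol) :=
  (splitWords isSep (field w 2)).2.map List.tail

/-- The partial ballot of the question, as a word. -/
def queryWord (w : List Symbol) : List Symbol := field w 3

/-- The number of ballots that give the issue `i` the value `b`: the weight for Kemeny's procedure.
-/
def support (w : List Symbol) (i : ℕ) (b : Bool) : ℕ :=
  (ballotWords w).countP fun r => hasBit b (r.getD i .star)

/-- Whether a strict majority gives the issue `i` the value `b`: the weight for Slater's procedure.
-/
def majoritySupport (w : List Symbol) (i : ℕ) (b : Bool) : ℕ :=
  bif decide ((ballotWords w).length < support w i b + support w i b) then 1 else 0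

section Evaluation

variable (W : List Symbol → ℕ → Bool → ℕ)

/-- The loss of the value `b` of the issue `i`, for a weight `W` that depends on the input `w`. -/
def lossIn (w : List Symbol) (i : ℕ) (b : Bool) : ℕ := W w i (!b) - W w i b

/-- The cost of the value `b` of the issue `i`, given the partial ballot `q`. The length of the
input serves as infinity. -/
def costIn (w q : List Symbol) (i : ℕ) (b : Bool) : ℕ :=
  bif isStar (q.getD i .star) then lossIn W w i b
  else bif hasBit b (q.getD i .star) then 0 else w.length

/-- The children of a node, given as a word. -/
def childIndices (g : List Symbol) : List ℕ := (splitWords isSep g).2.map fun c => c.tail.length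

/-- The value of a node, given the values `v` of all nodes: minimal costs, cut off at infinity. -/
def nodeValue (w q : List Symbol) (v : List ℕ) (g : List Symbol) : ℕ :=
  min w.length
    (bif isConj (g.headD .top) then ((childIndices g).map fun c => v.getD c 0).sum
    else bif isDisj (g.headD .top) then
      (childIndices g).foldr (fun c m => min (v.getD c 0) m) w.length
    else bif isIssue (g.headD .top) then costIn W w q g.tail.length (polarity (g.headD .top))
    else bif isBot (g.headD .top) then w.length else 0)

/-- One pass over the list of nodes. -/
def valuePass (w q : List Symbol) (v : List ℕ) : List ℕ := (gateWords w).map (nodeValue W w q v)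

/-- The values of the nodes after as many passes as there are nodes. The defaults that are read off
the empty list in the first pass do not matter in the end. -/
def valueTable (w q : List Symbol) : List ℕ := (valuePass W w q)^[(gateWords w).length] []

/-- The total loss of the values that are prescribed by the partial ballot `q`. -/
def queryLoss (w q : List Symbol) : ℕ :=
  ((List.range (issueCount w)).map fun i =>
    bif isStar (q.getD i .star) then 0 else lossIn W w i (polarity (q.getD i .star))).sum

/-- The minimal total loss of a rational ballot with which the partial ballot `q` agrees, or a
number that is at least the length of the input if there is none. -/
def minLoss (w q : List Symbol) : ℕ := (valueTable W w q).getD (rootIndex w) 0 + queryLoss W w q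

/-- The decision procedure: does the partial ballot of the question allow for as small a loss as the
empty partial ballot? -/
def answer (w : List Symbol) : Bool := decide (minLoss W w (queryWord w) ≤ minLoss W w [])

end Evaluation

/-! ### The algorithm runs in polynomial time -/

section PolyTime

variable {α : Type} [Code α]

@[fun_prop]
theorem polyTime_splitWords {H : Symbol → Bool} {w : α → List Symbol} (hw : PolyTime w) :
    PolyTime fun a => splitWords H (w a) := by
  refine PolyTime.foldr (g := fun _ => splitStep H) hw (.const ([], [])) ?_ ?_
  · have : PolyTime H := polyTime_symbol H .id
    unfold splitStep
    fun_prop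
  · obtain ⟨q, hq⟩ := hw.size_le
    refine ⟨q + 3, fun x s hs ⟨u, l⟩ => ?_⟩
    have := (size_le_of_mem hs).trans (hq x)
    unfold splitStep
    cases H s <;> simp <;> omega

section

variable {s : α → Symbol}

@[fun_prop] theorem polyTime_isStar (hs : PolyTime s) : PolyTime fun a => isStar (s a) :=
  polyTime_symbol _ hs

@[fun_prop] theorem polyTime_isConj (hs : PolyTime s) : PolyTime fun a => isConj (s a) :=
  polyTime_symbol _ hs

@[fun_prop] theorem polyTime_isDisj (hs : PolyTime s) : PolyTime fun a => isDisj (s a) :=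
  polyTime_symbol _ hs

@[fun_prop] theorem polyTime_isBot (hs : PolyTime s) : PolyTime fun a => isBot (s a) :=
  polyTime_symbol _ hs

@[fun_prop] theorem polyTime_isIssue (hs : PolyTime s) : PolyTime fun a => isIssue (s a) :=
  polyTime_symbol _ hs

@[fun_prop] theorem polyTime_isBit (hs : PolyTime s) : PolyTime fun a => isBit (s a) :=
  polyTime_symbol _ hs

@[fun_prop] theorem polyTime_polarity (hs : PolyTime s) : PolyTime fun a => polarity (s a) :=
  polyTime_symbol _ hs

@[fun_prop] theorem polyTime_hasBit {b : α → Bool} (hb : PolyTime b) (hs : PolyTime s) :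
    PolyTime fun a => hasBit (b a) (s a) := by
  unfold hasBit; fun_prop

end

variable {w q g : α → List Symbol} {v : α → List ℕ} {i : α → ℕ} {b : α → Bool}

@[fun_prop] theorem polyTime_field (hw : PolyTime w) (k : ℕ) : PolyTime fun a => field (w a) k := by
  unfold field; fun_prop

@[fun_prop] theorem polyTime_issueCount (hw : PolyTime w) : PolyTime fun a => issueCount (w a) := by
  unfold issueCount; fun_prop

@[fun_prop] theorem polyTime_rootIndex (hw : PolyTime w) : PolyTime fun a => rootIndex (w a) := by
  unfold rootIndex; fun_prop

@[fun_prop] theorem polyTime_gateWords (hw : PolyTime w) : PolyTime fun a => gateWords (w a) := by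
  unfold gateWords; fun_prop

@[fun_prop] theorem polyTime_ballotWords (hw : PolyTime w) :
    PolyTime fun a => ballotWords (w a) := by
  unfold ballotWords; fun_prop

@[fun_prop] theorem polyTime_queryWord (hw : PolyTime w) : PolyTime fun a => queryWord (w a) := by
  unfold queryWord; fun_prop

@[fun_prop] theorem polyTime_childIndices (hg : PolyTime g) :
    PolyTime fun a => childIndices (g a) := by
  unfold childIndices; fun_prop

theorem polyTime_support :
    PolyTime fun p : List Symbol × ℕ × Bool => support p.1 p.2.1 p.2.2 := by
  unfold support; fun_prop

theorem polyTime_majoritySupport :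
    PolyTime fun p : List Symbol × ℕ × Bool => majoritySupport p.1 p.2.1 p.2.2 := by
  have := polyTime_support
  unfold majoritySupport; fun_prop

section

variable {W : List Symbol → ℕ → Bool → ℕ}
  (hW : PolyTime fun p : List Symbol × ℕ × Bool => W p.1 p.2.1 p.2.2)

include hW

theorem polyTime_lossIn (hw : PolyTime w) (hi : PolyTime i) (hb : PolyTime b) :
    PolyTime fun a => lossIn W (w a) (i a) (b a) := by
  have h₁ := hW.comp (f := fun a => (w a, i a, !b a)) (by fun_prop)
  have h₂ := hW.comp (f := fun a => (w a, i a, b a)) (by fun_prop)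
  exact h₁.sub h₂

theorem polyTime_costIn (hw : PolyTime w) (hq : PolyTime q) (hi : PolyTime i) (hb : PolyTime b) :
    PolyTime fun a => costIn W (w a) (q a) (i a) (b a) := by
  have := polyTime_lossIn hW hw hi hb
  unfold costIn; fun_prop

theorem polyTime_nodeValue (hw : PolyTime w) (hq : PolyTime q) (hv : PolyTime v)
    (hg : PolyTime g) : PolyTime fun a => nodeValue W (w a) (q a) (v a) (g a) := by
  have h₁ : PolyTime fun a =>
      costIn W (w a) (q a) (g a).tail.length (polarity ((g a).headD .top)) :=
    polyTime_costIn hW hw hq (by fun_prop) (by fun_prop)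
  have h₂ : PolyTime fun a => (childIndices (g a)).foldr (fun c m => min ((v a).getD c 0) m)
      (w a).length :=
    PolyTime.foldr (g := fun a c m => min ((v a).getD c 0) m) (by fun_prop) (by fun_prop)
      (by fun_prop) ⟨0, fun a c _ m => by simp⟩
  unfold nodeValue; fun_prop

theorem polyTime_valueTable (hw : PolyTime w) (hq : PolyTime q) :
    PolyTime fun a => valueTable W (w a) (q a) := by
  refine PolyTime.iterate (g := fun a => valuePass W (w a) (q a)) (by fun_prop) (.const []) ?_ ?_
  · refine PolyTime.map (g := fun (p : α × List ℕ) => nodeValue W (w p.1) (q p.1) p.2)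
      (by fun_prop) ?_
    exact polyTime_nodeValue hW (by fun_prop) (by fun_prop) (by fun_prop) (by fun_prop)
  · have bound : ∀ (B : ℕ) (l : List ℕ), (∀ k ∈ l, k ≤ B) →
        size l ≤ l.length * (2 * B + 2) + 1 := by
      intro B l
      induction l with
      | nil => simp
      | cons k l ih =>
        intro h
        have h₁ := ih fun k hk => h k (List.mem_cons_of_mem _ hk)
        have h₂ := h k List.mem_cons_self
        simp only [size_cons, size_nat, List.length_cons, Nat.add_mul]
        omega
    obtain ⟨r, hr⟩ := (polyTime_gateWords hw).size_le
    obtain ⟨r', hr'⟩ := hw.size_le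
    refine ⟨r * (2 * r' + 2) + 1, fun a v => ?_⟩
    refine (bound (w a).length _ ?_).trans ?_
    · simp [valuePass, nodeValue]
    · have h₁ := (length_le_size _).trans (hr a)
      have h₂ := (length_le_size _).trans (hr' a)
      simp only [valuePass, List.length_map, Polynomial.eval_add, Polynomial.eval_mul,
        Polynomial.eval_one, Polynomial.eval_ofNat]
      refine le_trans ?_ (Nat.le_add_left _ _)
      gcongr

theorem polyTime_minLoss (hw : PolyTime w) (hq : PolyTime q) :
    PolyTime fun a => minLoss W (w a) (q a) := by
  have h₁ := polyTime_valueTable hW hw hq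
  have h₂ : PolyTime fun a => queryLoss W (w a) (q a) := by
    have : PolyTime fun p : α × ℕ =>
        lossIn W (w p.1) p.2 (polarity ((q p.1).getD p.2 .star)) :=
      polyTime_lossIn hW (by fun_prop) (by fun_prop) (by fun_prop)
    unfold queryLoss; fun_prop
  unfold minLoss; fun_prop

theorem polyTime_answer : PolyTime (answer W) := by
  have h₁ := polyTime_minLoss hW (w := fun w => w) (q := fun w => queryWord w)
    (by fun_prop) (by fun_prop)
  have h₂ := polyTime_minLoss hW (w := fun w => w) (q := fun w => [])
    (by fun_prop) (by fun_prop)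
  unfold answer; fun_prop

end

end PolyTime

/-! ### Minimum costs in DNNF circuits -/

namespace NNFCircuit

variable {n : ℕ} (C : NNFCircuit n)

theorem vars_subset_of_arc {i j : Fin C.size} (h : C.Arc i j) : C.vars j ⊆ C.vars i :=
  fun _ ⟨k, b, hk, hg⟩ => ⟨k, b, Relation.ReflTransGen.head h hk, hg⟩

theorem value_congr {α β : Var n → Bool} (i : Fin C.size) (h : ∀ x ∈ C.vars i, α x = β x) :
    C.value α i = C.value β i := by
  induction i using C.wellFounded_child.induction with
  | _ i ih =>
    have hc : ∀ j ∈ (C.gate i).children, C.value α j = C.value β j := fun j hj =>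
      ih j hj fun x hx => h x (C.vars_subset_of_arc hj hx)
    rw [value_eq, value_eq]
    rcases hg : C.gate i with _ | _ | ⟨v, b⟩ | cs | cs
    · rfl
    · rfl
    · simp only
      rw [h v ⟨i, b, .refl, hg⟩]
    all_goals
      rw [hg] at hc
      rw [Bool.eq_iff_iff]
      simp only [Gate.children] at hc
      simp only [List.all_eq_true, List.any_eq_true]
    · exact forall₂_congr fun j hj => by rw [hc j hj]
    · exact exists_congr fun j => and_congr_right fun hj => by rw [hc j hj]

/-- The number of proper descendants of a node. -/
noncomputable def rank (i : Fin C.size) : ℕ := {j | Relation.TransGen C.Arc i j}.ncard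

theorem rank_lt_of_arc {i j : Fin C.size} (h : C.Arc i j) : C.rank j < C.rank i := by
  refine Set.ncard_lt_ncard ⟨fun k hk => Relation.TransGen.head h hk, fun hs => ?_⟩
  exact C.acyclic j (hs (Relation.TransGen.single h))

theorem rank_lt_size (i : Fin C.size) : C.rank i < C.size := by
  have : {j | Relation.TransGen C.Arc i j} ⊂ Set.univ :=
    Set.ssubset_univ_iff.mpr fun h => C.acyclic i (by rw [Set.eq_univ_iff_forall] at h; exact h i)
  simpa [Set.ncard_univ, rank] using Set.ncard_lt_ncard this

end NNFCircuit

section Cost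

variable {n : ℕ} (c : Fin n → Bool → ℕ) (B : ℕ)

open Classical in
/-- The cost of the values that an assignment gives to the issues in a set of variables. -/
noncomputable def costOn (S : Set (Var n)) (α : Var n → Bool) : ℕ :=
  ∑ x : Fin n, if Sum.inl x ∈ S then c x (α (Sum.inl x)) else 0

theorem costOn_mono {S T : Set (Var n)} (h : S ⊆ T) (α : Var n → Bool) :
    costOn c S α ≤ costOn c T α := by
  classical
  refine Finset.sum_le_sum fun x _ => ?_
  by_cases hx : Sum.inl x ∈ S
  · simp [hx, h hx]
  · simp [hx]

theorem costOn_add_le {S T U : Set (Var n)} (h : Disjoint S T) (hS : S ⊆ U) (hT : T ⊆ U)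
    (α : Var n → Bool) : costOn c S α + costOn c T α ≤ costOn c U α := by
  classical
  rw [costOn, costOn, ← Finset.sum_add_distrib]
  refine Finset.sum_le_sum fun x _ => ?_
  by_cases hx : Sum.inl x ∈ S
  · simp [hx, hS hx, Set.disjoint_left.mp h hx]
  · by_cases hx' : Sum.inl x ∈ T
    · simp [hx, hx', hT hx']
    · simp [hx, hx']

theorem costOn_univ (α : Var n → Bool) :
    costOn c Set.univ α = ∑ x : Fin n, c x (α (Sum.inl x)) := by simp [costOn]

/-- The cost of a node in terms of the costs of its children; `B` is infinity. -/
def gateCost {m : ℕ} (v : Fin m → ℕ) : Gate n m → ℕ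
  | .top => 0
  | .bot => B
  | .lit (.inl x) b => c x b
  | .lit (.inr _) _ => 0
  | .conj cs => (cs.map v).sum
  | .disj cs => cs.foldr (fun j k => min (v j) k) B

/-- The number `k` is the minimal cost of making the node `i` true, up to cutting off at `B`. The
lower bound counts the issues that occur below `i` only, so that lower bounds for conjuncts can be
added. -/
structure IsMinCost (C : NNFCircuit n) (i : Fin C.size) (k : ℕ) : Prop where
  le_costOn : ∀ α, C.value α i = true → k ≤ costOn c (C.vars i) α
  exists_le : k < B → ∃ α, C.value α i = true ∧ ∑ x : Fin n, c x (α (Sum.inl x)) ≤ k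

/-- Optimal assignments for nodes without common variables can be merged. -/
theorem exists_common_assignment {c : Fin n → Bool → ℕ} {B : ℕ} (hc : ∀ x, ∃ b, c x b = 0)
    {C : NNFCircuit n} {v : Fin C.size → ℕ} (cs : List (Fin C.size))
    (hv : ∀ j ∈ cs, IsMinCost c B C j (v j))
    (hcs : cs.Pairwise fun i j => Disjoint (C.vars i) (C.vars j)) (hB : (cs.map v).sum < B) :
    ∃ α, (∀ j ∈ cs, C.value α j = true) ∧ ∑ x : Fin n, c x (α (Sum.inl x)) ≤ (cs.map v).sum := by
  classical
  induction cs with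
  | nil =>
    choose z hz using hc
    exact ⟨Sum.elim z fun _ => false, by simp, by simp [hz]⟩
  | cons j cs ih =>
    rw [List.map_cons, List.sum_cons] at hB ⊢
    rw [List.pairwise_cons] at hcs
    obtain ⟨α, hα, hαc⟩ := (hv j List.mem_cons_self).exists_le (by omega)
    obtain ⟨β, hβ, hβc⟩ := ih (fun i hi => hv i (List.mem_cons_of_mem _ hi)) hcs.2 (by omega)
    refine ⟨fun x => if x ∈ C.vars j then α x else β x, fun i hi => ?_, ?_⟩
    · rcases List.mem_cons.mp hi with rfl | hi
      · rw [← hα]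
        exact C.value_congr i fun x hx => by simp [hx]
      · rw [← hβ i hi]
        exact C.value_congr i fun x hx => by
          simp [Set.disjoint_right.mp (hcs.1 i hi) hx]
    · refine le_trans ?_ (add_le_add hαc hβc)
      rw [← Finset.sum_add_distrib]
      refine Finset.sum_le_sum fun x _ => ?_
      by_cases hx : Sum.inl x ∈ C.vars j <;> simp [hx]

/-- For nodes without common variables, lower bounds add up. -/
theorem sum_le_costOn {c : Fin n → Bool → ℕ} {B : ℕ} {C : NNFCircuit n} {v : Fin C.size → ℕ}
    (cs : List (Fin C.size)) (hv : ∀ j ∈ cs, IsMinCost c B C j (v j))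
    (hcs : cs.Pairwise fun i j => Disjoint (C.vars i) (C.vars j)) (α : Var n → Bool)
    (hα : ∀ j ∈ cs, C.value α j = true) :
    (cs.map v).sum ≤ costOn c (⋃ j ∈ cs, C.vars j) α := by
  induction cs with
  | nil => simp
  | cons j cs ih =>
    rw [List.map_cons, List.sum_cons]
    rw [List.pairwise_cons] at hcs
    have h₁ := (hv j List.mem_cons_self).le_costOn α (hα j List.mem_cons_self)
    have h₂ := ih (fun i hi => hv i (List.mem_cons_of_mem _ hi)) hcs.2
      (fun i hi => hα i (List.mem_cons_of_mem _ hi))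
    refine (add_le_add h₁ h₂).trans (costOn_add_le c ?_ ?_ ?_ α)
    · simpa using hcs.1
    · intro x hx; simp [hx]
    · intro x hx
      simp only [Set.mem_iUnion] at hx ⊢
      obtain ⟨i, hi, hx⟩ := hx
      exact ⟨i, List.mem_cons_of_mem _ hi, hx⟩

theorem foldr_min_le {ι : Type} (v : ι → ℕ) (l : List ι) {j : ι} (h : j ∈ l) :
    l.foldr (fun j k => min (v j) k) B ≤ v j := by
  induction l with
  | nil => simp at h
  | cons i l ih =>
    rcases List.mem_cons.mp h with rfl | h
    · simp
    · have := ih h; simp only [List.foldr_cons]; omega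

theorem exists_foldr_min_eq {ι : Type} (v : ι → ℕ) (l : List ι)
    (h : l.foldr (fun j k => min (v j) k) B < B) :
    ∃ j ∈ l, v j = l.foldr (fun j k => min (v j) k) B := by
  induction l with
  | nil => simp at h
  | cons i l ih =>
    simp only [List.foldr_cons] at h ⊢
    rcases le_total (v i) (l.foldr (fun j k => min (v j) k) B) with h' | h'
    · exact ⟨i, List.mem_cons_self, by omega⟩
    · obtain ⟨j, hj, e⟩ := ih (by omega)
      exact ⟨j, List.mem_cons_of_mem _ hj, by omega⟩

theorem gateCost_le_costOn {c : Fin n → Bool → ℕ} {B : ℕ} {C : NNFCircuit n}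
    (hC : C.Decomposable) {v : Fin C.size → ℕ} (i : Fin C.size)
    (hv : ∀ j, C.Arc i j → IsMinCost c B C j (v j)) (α : Var n → Bool)
    (hα : C.value α i = true) : gateCost c B v (C.gate i) ≤ costOn c (C.vars i) α := by
  have arc : ∀ {j}, j ∈ (C.gate i).children → C.Arc i j := fun h => h
  rw [NNFCircuit.value_eq] at hα
  generalize hg : C.gate i = g at hα arc
  rcases g with _ | _ | ⟨x | a, b⟩ | cs | cs
  · exact Nat.zero_le _
  · simp at hα
  · classical
    have hb : α (Sum.inl x) = b := by simpa using hα
    have hx : Sum.inl x ∈ C.vars i := ⟨i, b, .refl, hg⟩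
    have := Finset.single_le_sum (f := fun y : Fin n =>
      if Sum.inl y ∈ C.vars i then c y (α (Sum.inl y)) else 0) (fun _ _ => Nat.zero_le _)
      (Finset.mem_univ x)
    simpa [hx, hb, costOn, gateCost] using this
  · exact Nat.zero_le _
  · have hα' : ∀ j ∈ cs, C.value α j = true := List.all_eq_true.mp hα
    have h := sum_le_costOn cs (fun j hj => hv j (arc hj)) (hC i cs hg) α hα'
    have hs : ⋃ j ∈ cs, C.vars j ⊆ C.vars i := by
      simp only [Set.iUnion_subset_iff]
      exact fun j hj => C.vars_subset_of_arc (arc hj)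
    exact h.trans (costOn_mono c hs α)
  · obtain ⟨j, hj, hα'⟩ := List.any_eq_true.mp hα
    have h := ((hv j (arc hj)).le_costOn α hα').trans
      (costOn_mono c (C.vars_subset_of_arc (arc hj)) α)
    exact (foldr_min_le B v cs hj).trans h

theorem exists_le_gateCost {c : Fin n → Bool → ℕ} {B : ℕ} (hc : ∀ x, ∃ b, c x b = 0)
    {C : NNFCircuit n} (hC : C.Decomposable) {v : Fin C.size → ℕ} (i : Fin C.size)
    (hv : ∀ j, C.Arc i j → IsMinCost c B C j (v j)) (hlt : gateCost c B v (C.gate i) < B) :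
    ∃ α, C.value α i = true ∧
      ∑ x : Fin n, c x (α (Sum.inl x)) ≤ gateCost c B v (C.gate i) := by
  have arc : ∀ {j}, j ∈ (C.gate i).children → C.Arc i j := fun h => h
  choose z hz using hc
  simp only [NNFCircuit.value_eq C _ i]
  generalize hg : C.gate i = g at hlt arc
  rcases g with _ | _ | ⟨x | a, b⟩ | cs | cs
  · exact ⟨Sum.elim z fun _ => false, rfl, by simp [hz]⟩
  · exact absurd hlt (lt_irrefl B)
  · refine ⟨Sum.elim (Function.update z x b) fun _ => false, by simp, ?_⟩
    rw [Finset.sum_eq_single x]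
    · simp [gateCost]
    · intro y _ hy; simp [hy, hz]
    · simp
  · exact ⟨Sum.elim z fun _ => b, by simp, by simp [hz]⟩
  · obtain ⟨α, hα, h⟩ := exists_common_assignment (fun x => ⟨z x, hz x⟩) cs
      (fun j hj => hv j (arc hj)) (hC i cs hg) hlt
    exact ⟨α, List.all_eq_true.mpr hα, h⟩
  · obtain ⟨j, hj, e⟩ := exists_foldr_min_eq B v cs hlt
    obtain ⟨α, hα, h⟩ := (hv j (arc hj)).exists_le (e.trans_lt hlt)
    exact ⟨α, List.any_eq_true.mpr ⟨j, hj, hα⟩, h.trans e.le⟩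

/-- The min-plus recursion is correct on decomposable circuits. -/
theorem isMinCost_gateCost {c : Fin n → Bool → ℕ} {B : ℕ} (hc : ∀ x, ∃ b, c x b = 0)
    {C : NNFCircuit n} (hC : C.Decomposable) {v : Fin C.size → ℕ} (i : Fin C.size)
    (hv : ∀ j, C.Arc i j → IsMinCost c B C j (v j)) :
    IsMinCost c B C i (min B (gateCost c B v (C.gate i))) := by
  refine ⟨fun α hα => (min_le_right _ _).trans (gateCost_le_costOn hC i hv α hα), fun hlt => ?_⟩
  have h : gateCost c B v (C.gate i) < B := by omega
  rw [min_eq_right h.le]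
  exact exists_le_gateCost hc hC i hv h

end Cost

/-! ### Reading an instance -/

section Parsing

variable {H : Symbol → Bool}

theorem splitWords_append {u : List Symbol} (hu : ∀ x ∈ u, H x = false) (w : List Symbol) :
    splitWords H (u ++ w) = (u ++ (splitWords H w).1, (splitWords H w).2) := by
  induction u with
  | nil => rfl
  | cons x u ih =>
    have h := ih fun y hy => hu y (List.mem_cons_of_mem _ hy)
    rw [splitWords] at h
    rw [List.cons_append, splitWords, List.foldr_cons, h, splitStep, hu x List.mem_cons_self]
    rfl

theorem splitWords_of_forall {u : List Symbol} (hu : ∀ x ∈ u, H x = false) :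
    splitWords H u = (u, []) := by
  simpa [splitWords] using splitWords_append hu []

theorem splitWords_cons {x : Symbol} (hx : H x = true) (w : List Symbol) :
    splitWords H (x :: w) = ([], (x :: (splitWords H w).1) :: (splitWords H w).2) := by
  rw [splitWords, List.foldr_cons, splitStep, hx]; rfl

theorem splitWords_append_cons {u : List Symbol} (hu : ∀ x ∈ u, H x = false) {x : Symbol}
    (hx : H x = true) (w : List Symbol) :
    splitWords H (u ++ x :: w) = (u, (x :: (splitWords H w).1) :: (splitWords H w).2) := by
  rw [splitWords_append hu, splitWords_cons hx, List.append_nil]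

theorem splitWords_flatten {L : List (List Symbol)}
    (hL : ∀ w ∈ L, ∃ a t, w = a :: t ∧ H a = true ∧ ∀ x ∈ t, H x = false) :
    splitWords H L.flatten = ([], L) := by
  induction L with
  | nil => rfl
  | cons w L ih =>
    obtain ⟨a, t, rfl, ha, ht⟩ := hL w List.mem_cons_self
    rw [List.flatten_cons, List.cons_append, splitWords_cons ha, splitWords_append ht,
      ih fun w hw => hL w (List.mem_cons_of_mem _ hw), List.append_nil]

theorem isBar_eq_false {u : List Symbol} (h : Symbol.bar ∉ u) : ∀ x ∈ u, isBar x = false := by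
  intro x hx
  cases x <;> first | rfl | exact absurd hx h

theorem bar_notMem_encodeIndex (k : ℕ) : Symbol.bar ∉ encodeIndex k :=
  fun h => by simpa using mem_encodeIndex h

theorem bar_notMem_encodePartialBallot {n : ℕ} (s : PartialBallot n) :
    Symbol.bar ∉ encodePartialBallot s := by
  intro h
  obtain ⟨i, hi⟩ := (List.mem_ofFn' _ _).mp h
  rcases hs : s i with _ | b <;> simp [hs] at hi

theorem splitWords_isBar_encode (I : DNNFInstance) :
    splitWords isBar I.encode = (encodeIndex I.n,
      [.bar :: encodeIndex I.circuit.root,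
       .bar :: (List.ofFn fun i => (I.circuit.gate i).encode).flatten,
       .bar :: (I.profile.map encodeBallot).flatten,
       .bar :: encodePartialBallot I.query]) := by
  rw [DNNFInstance.encode, splitWords_append_cons (isBar_eq_false (bar_notMem_encodeIndex _)) rfl,
    splitWords_append_cons (isBar_eq_false (bar_notMem_encodeIndex _)) rfl,
    splitWords_append_cons (isBar_eq_false (bar_notMem_gates _)) rfl,
    splitWords_append_cons (isBar_eq_false (bar_notMem_profile _)) rfl,
    splitWords_of_forall (isBar_eq_false (bar_notMem_encodePartialBallot _))]

variable (I : DNNFInstance)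

theorem issueCount_encode : issueCount I.encode = I.n := by
  simp [issueCount, splitWords_isBar_encode, encodeIndex]

theorem rootIndex_encode : rootIndex I.encode = I.circuit.root := by
  simp [rootIndex, field, splitWords_isBar_encode, encodeIndex]

theorem queryWord_encode : queryWord I.encode = encodePartialBallot I.query := by
  simp [queryWord, field, splitWords_isBar_encode]

theorem isGateStart_eq_true_iff (x : Symbol) : isGateStart x = true ↔ IsGateHead x := by
  cases x <;> simp [isGateStart, IsGateHead]

theorem gateWords_encode :
    gateWords I.encode = List.ofFn fun i => (I.circuit.gate i).encode := by
  have : field I.encode 1 = (List.ofFn fun i => (I.circuit.gate i).encode).flatten := by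
    simp [field, splitWords_isBar_encode]
  rw [gateWords, this, splitWords_flatten]
  intro w hw
  obtain ⟨i, rfl⟩ := (List.mem_ofFn' _ _).mp hw
  obtain ⟨a, t, h, ha, ht⟩ := (I.circuit.gate i).encode_head
  exact ⟨a, t, h, (isGateStart_eq_true_iff a).mpr ha, fun x hx =>
    Bool.eq_false_iff.mpr fun h => (ht x hx).1 ((isGateStart_eq_true_iff x).mp h)⟩

theorem ballotWords_encode :
    ballotWords I.encode = I.profile.map fun r => List.ofFn fun i => Symbol.bit (r i) := by
  have : field I.encode 2 = (I.profile.map encodeBallot).flatten := by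
    simp [field, splitWords_isBar_encode]
  rw [ballotWords, this, splitWords_flatten]
  · simp [encodeBallot, Function.comp_def]
  · intro w hw
    obtain ⟨r, _, rfl⟩ := List.mem_map.mp hw
    refine ⟨_, _, rfl, rfl, fun x hx => ?_⟩
    obtain ⟨i, rfl⟩ := (List.mem_ofFn' _ _).mp hx
    rfl

theorem childIndices_conj {m : ℕ} (x : Symbol) (hx : isSep x = false) (cs : List (Fin m)) :
    childIndices (x :: encodeChildren cs) = cs.map Fin.val := by
  have h : splitWords isSep (encodeChildren cs) =
      ([], cs.map fun c : Fin m => Symbol.sep :: encodeIndex c.val) := by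
    refine splitWords_flatten fun w hw => ?_
    obtain ⟨c, _, rfl⟩ := List.mem_map.mp hw
    exact ⟨_, _, rfl, rfl, fun y hy => by rw [mem_encodeIndex hy]; rfl⟩
  have h' := splitWords_append (H := isSep) (u := [x]) (by simpa using hx) (encodeChildren cs)
  rw [List.singleton_append] at h'
  simp [childIndices, h', h, encodeIndex, Function.comp_def]

theorem hasBit_bit (b b' : Bool) : hasBit b (.bit b') = decide (b' = b) := by
  cases b <;> cases b' <;> rfl

theorem getD_ofFn {A : Type} {m : ℕ} (f : Fin m → A) (i : Fin m) (d : A) :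
    (List.ofFn f).getD i d = f i := by
  simp [List.getD_eq_getElem?_getD]

theorem support_encode (i : Fin I.n) (b : Bool) :
    support I.encode i b = I.profile.countP fun r => r i = b := by
  simp only [support, ballotWords_encode, List.countP_map, Function.comp_def, getD_ofFn, hasBit_bit]

theorem length_mul_lt_length_encode : I.profile.length * I.n < I.encode.length := by
  have h : ((I.profile.map encodeBallot).flatten).length = I.profile.length * (I.n + 1) := by
    simp [List.length_flatten, Function.comp_def, encodeBallot]
  have : I.encode.length ≥ ((I.profile.map encodeBallot).flatten).length + 1 := by
    simp only [DNNFInstance.encode, List.length_append, List.length_cons]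
    omega
  rw [h, Nat.mul_add] at this
  omega

end Parsing

/-! ### Correctness of the algorithm -/

section Loss

variable {n : ℕ} (w : Fin n → Bool → ℕ)

/-- What is lost by choosing the value `b` for the issue `i` and not the better one: the truncated
difference is zero if `b` is the better one. -/
def loss (i : Fin n) (b : Bool) : ℕ := w i (!b) - w i b

/-- The costs that describe losses under the restriction to ballots with which `s` agrees; `B` is
infinity. On issues decided by `s` the loss is accounted for by `forcedLoss`, so that one value is
always free. -/
def queryCost (B : ℕ) (s : PartialBallot n) (i : Fin n) (b : Bool) : ℕ :=
  match s i with
  | none => loss w i b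
  | some b' => if b' = b then 0 else B

/-- The loss on the issues decided by `s`, common to all ballots with which `s` agrees. -/
def forcedLoss (s : PartialBallot n) : ℕ :=
  ∑ i, match s i with
    | none => 0
    | some b => loss w i b

theorem exists_queryCost_eq_zero (B : ℕ) (s : PartialBallot n) (i : Fin n) :
    ∃ b, queryCost w B s i b = 0 := by
  unfold queryCost loss
  rcases s i with _ | b
  · rcases le_total (w i true) (w i false) with h | h
    · exact ⟨false, by simpa using Nat.sub_eq_zero_of_le h⟩
    · exact ⟨true, by simpa using Nat.sub_eq_zero_of_le h⟩
  · exact ⟨b, by simp⟩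

theorem sum_queryCost_add_forcedLoss {B : ℕ} {s : PartialBallot n} {r : Ballot n}
    (h : s.AgreesWith r) :
    ∑ i, queryCost w B s i (r i) + forcedLoss w s = ∑ i, loss w i (r i) := by
  rw [forcedLoss, ← Finset.sum_add_distrib]
  refine Finset.sum_congr rfl fun i _ => ?_
  have := h i
  unfold queryCost
  rcases hs : s i with _ | b
  · simp
  · have hb : b = r i := by simpa [hs] using this
    simp [hb]

theorem agreesWith_of_sum_queryCost_lt {B : ℕ} {s : PartialBallot n} {r : Ballot n}
    (h : ∑ i, queryCost w B s i (r i) < B) : s.AgreesWith r := by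
  intro i hi
  have h₁ := Finset.single_le_sum (f := fun i => queryCost w B s i (r i))
    (fun _ _ => Nat.zero_le _) (Finset.mem_univ i)
  have h₂ : queryCost w B s i (r i) < B := lt_of_le_of_lt h₁ h
  unfold queryCost at h₂
  rcases hs : s i with _ | b
  · exact absurd hs hi
  · rw [hs] at h₂
    by_contra hb
    have hb' : b ≠ r i := fun h => hb (by rw [h])
    simp [hb'] at h₂

theorem sum_add_sum_loss (r : Ballot n) :
    ∑ i, w i (r i) + ∑ i, loss w i (r i) = ∑ i, max (w i true) (w i false) := by
  rw [← Finset.sum_add_distrib]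
  refine Finset.sum_congr rfl fun i _ => ?_
  unfold loss
  cases r i <;> simp only [Bool.not_true, Bool.not_false] <;> omega

end Loss

section Correctness

/-- The word `q` lists the entries of the partial ballot `s`. Positions beyond its end count as
undecided; thus the empty word represents the partial ballot that decides nothing. -/
def Represents {n : ℕ} (q : List Symbol) (s : PartialBallot n) : Prop :=
  ∀ i : Fin n, q.getD i .star = match s i with
    | some b => .bit b
    | none => .star

theorem represents_nil (n : ℕ) : Represents [] (fun _ : Fin n => none) := fun _ => rfl

theorem represents_encodePartialBallot {n : ℕ} (s : PartialBallot n) :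
    Represents (encodePartialBallot s) s := fun i => getD_ofFn _ i _

variable {W : List Symbol → ℕ → Bool → ℕ} {I : DNNFInstance} {w : Fin I.n → Bool → ℕ}
  (hW : ∀ (i : Fin I.n) (b : Bool), W I.encode i b = w i b)
  {q : List Symbol} {s : PartialBallot I.n} (hq : Represents q s)

include hW in
theorem lossIn_encode (i : Fin I.n) (b : Bool) : lossIn W I.encode i b = loss w i b := by
  rw [lossIn, hW, hW, loss]

include hW hq

theorem costIn_encode (i : Fin I.n) (b : Bool) :
    costIn W I.encode q i b = queryCost w I.encode.length s i b := by
  rw [costIn, hq i, queryCost, lossIn_encode hW]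
  rcases s i with _ | b'
  · rfl
  · rw [hasBit_bit]
    by_cases h : b' = b <;> simp [h, isStar]

theorem nodeValue_encode (v : List ℕ) (g : Gate I.n I.circuit.size) :
    nodeValue W I.encode q v g.encode = min I.encode.length
      (gateCost (queryCost w I.encode.length s) I.encode.length (fun j => v.getD j 0) g) := by
  unfold nodeValue
  rcases g with _ | _ | ⟨x | a, b⟩ | cs | cs
  · rfl
  · rfl
  · simp only [Gate.encode, List.headD_cons, isConj, isDisj, isIssue, cond_true, cond_false,
      List.tail_cons, encodeIndex, List.length_replicate, polarity, costIn_encode hW hq, gateCost]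
  · rfl
  · simp only [Gate.encode, List.headD_cons, isConj, cond_true, childIndices_conj .conj rfl,
      List.map_map, gateCost]
    rfl
  · simp only [Gate.encode, List.headD_cons, isConj, isDisj, cond_true, cond_false,
      childIndices_conj .disj rfl, List.foldr_map, gateCost]

/-- After `t` passes, the values are correct for all nodes with fewer than `t` proper descendants.
-/
theorem isMinCost_valuePass_iterate (t : ℕ) (i : Fin I.circuit.size) (hi : I.circuit.rank i < t) :
    IsMinCost (queryCost w I.encode.length s) I.encode.length I.circuit i
      (((valuePass W I.encode q)^[t] []).getD i 0) := by
  induction t generalizing i with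
  | zero => omega
  | succ t ih =>
    rw [Function.iterate_succ_apply', valuePass, gateWords_encode, List.map_ofFn, getD_ofFn,
      Function.comp_apply, nodeValue_encode hW hq]
    refine isMinCost_gateCost (exists_queryCost_eq_zero w _ s) I.decomposable i fun j hj => ?_
    exact ih j (by have := I.circuit.rank_lt_of_arc hj; omega)

theorem isMinCost_root : IsMinCost (queryCost w I.encode.length s) I.encode.length I.circuit
    I.circuit.root ((valueTable W I.encode q).getD (rootIndex I.encode) 0) := by
  rw [rootIndex_encode, valueTable]
  refine isMinCost_valuePass_iterate hW hq _ _ ?_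
  rw [gateWords_encode, List.length_ofFn]
  exact I.circuit.rank_lt_size _

theorem queryLoss_encode : queryLoss W I.encode q = forcedLoss w s := by
  rw [queryLoss, issueCount_encode, forcedLoss]
  refine (Finset.sum_range _).trans (Finset.sum_congr rfl fun i _ => ?_)
  rw [hq i]
  rcases s i with _ | b
  · rfl
  · exact lossIn_encode hW i b

theorem minLoss_le {r : Ballot I.n} (hr : r ∈ I.circuit.rational) (hs : s.AgreesWith r) :
    minLoss W I.encode q ≤ ∑ i, loss w i (r i) := by
  obtain ⟨β, hβ⟩ := hr
  have h := ((isMinCost_root hW hq).le_costOn _ hβ).trans (costOn_mono _ (Set.subset_univ _) _)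
  rw [costOn_univ] at h
  rw [minLoss, queryLoss_encode hW hq, ← sum_queryCost_add_forcedLoss w (B := I.encode.length) hs]
  exact Nat.add_le_add_right h _

theorem exists_le_minLoss (h : minLoss W I.encode q < I.encode.length) :
    ∃ r ∈ I.circuit.rational, s.AgreesWith r ∧ ∑ i, loss w i (r i) ≤ minLoss W I.encode q := by
  have hlt : (valueTable W I.encode q).getD (rootIndex I.encode) 0 < I.encode.length :=
    lt_of_le_of_lt (Nat.le_add_right _ _) h
  obtain ⟨α, hα, hc⟩ := (isMinCost_root hW hq).exists_le hlt
  have hs : s.AgreesWith fun i => α (Sum.inl i) :=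
    agreesWith_of_sum_queryCost_lt w (hc.trans_lt hlt)
  refine ⟨fun i => α (Sum.inl i), ⟨fun j => α (Sum.inr j), ?_⟩, hs, ?_⟩
  · have : Sum.elim (fun i => α (Sum.inl i)) (fun j => α (Sum.inr j)) = α := by
      funext x; cases x <;> rfl
    rw [this]; exact hα
  · rw [minLoss, queryLoss_encode hW hq,
      ← sum_queryCost_add_forcedLoss w (B := I.encode.length) hs]
    exact Nat.add_le_add_right hc _

omit hq

/-- The decision procedure is correct. A ballot of the profile shows that the unrestricted minimum
is finite; if the restricted minimum does not exceed it, then it is finite as well and attained by a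
ballot. -/
theorem answer_encode_eq_true_iff (hw : ∀ i b, w i b ≤ I.profile.length) :
    answer W I.encode = true ↔ ∃ r ∈ I.circuit.rational, I.query.AgreesWith r ∧
      ∀ r' ∈ I.circuit.rational, ∑ i, w i (r' i) ≤ ∑ i, w i (r i) := by
  have hq : Represents (queryWord I.encode) I.query := by
    rw [queryWord_encode]; exact represents_encodePartialBallot _
  have h₀ := represents_nil I.n
  have hnone : ∀ r : Ballot I.n, PartialBallot.AgreesWith (fun _ => none) r :=
    fun r i hi => absurd rfl hi
  have hopt : minLoss W I.encode [] < I.encode.length := by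
    obtain ⟨r, hr⟩ := List.exists_mem_of_ne_nil _ I.profile_ne_nil
    refine (minLoss_le hW h₀ (I.profile_rational r hr) (hnone r)).trans_lt
      (lt_of_le_of_lt ?_ (length_mul_lt_length_encode I))
    refine (Finset.sum_le_card_nsmul _ _ I.profile.length fun i _ =>
      (Nat.sub_le _ _).trans (hw i _)).trans ?_
    simp [Nat.mul_comm]
  rw [answer, decide_eq_true_iff]
  constructor
  · intro h
    obtain ⟨r, hr, hs, hle⟩ := exists_le_minLoss hW hq (h.trans_lt hopt)
    refine ⟨r, hr, hs, fun r' hr' => ?_⟩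
    have h₁ := minLoss_le hW h₀ hr' (hnone r')
    have h₂ := sum_add_sum_loss w r
    have h₃ := sum_add_sum_loss w r'
    omega
  · rintro ⟨r, hr, hs, hmax⟩
    obtain ⟨r', hr', -, hle⟩ := exists_le_minLoss hW h₀ hopt
    have h₁ := minLoss_le hW hq hr hs
    have h₂ := sum_add_sum_loss w r
    have h₃ := sum_add_sum_loss w r'
    have h₄ := hmax r' hr'
    omega

end Correctness

/-! ### The weights of the Kemeny and Slater procedures -/

/-- The Kemeny score counts, issue by issue, the ballots that agree with `r`. -/
theorem totalScore_litVal {n : ℕ} (p : List (Ballot n)) (r : Ballot n) :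
    totalScore (fun r l => litVal r l) p r = ∑ i, p.countP fun r' => r' i = r i := by
  have key : ∀ r' : Ballot n, ∑ l : IssueLit n with litVal r l = 1, litVal r' l =
      ∑ i, if r' i = r i then 1 else 0 := by
    intro r'
    rw [Finset.sum_filter, Fintype.sum_prod_type]
    refine Finset.sum_congr rfl fun i _ => ?_
    cases h : r i <;> cases h' : r' i <;> simp [litVal, h, h']
  rw [totalScore]
  induction p with
  | nil => simp
  | cons r' p ih =>
    rw [List.map_cons, List.sum_cons, ih, key, ← Finset.sum_add_distrib]
    refine Finset.sum_congr rfl fun i _ => ?_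
    rw [List.countP_cons, Nat.add_comm]
    simp

/-- The weight of Slater's procedure: a strict majority gives the issue `i` the value `b`. -/
def majorityWeight {n : ℕ} (p : List (Ballot n)) (i : Fin n) (b : Bool) : ℕ :=
  if p.length < 2 * p.countP (fun r => r i = b) then 1 else 0

theorem countP_true_add_countP_false {n : ℕ} (p : List (Ballot n)) (i : Fin n) :
    p.countP (fun r => r i = true) + p.countP (fun r => r i = false) = p.length := by
  rw [List.length_eq_countP_add_countP (fun r : Ballot n => decide (r i = true))]
  simp

/-- Every issue counts either for the distance to the majority outcome or for the weight. -/
theorem hammingToPartial_add {n : ℕ} (p : List (Ballot n)) (r : Ballot n) :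
    hammingToPartial r (majority p) + ∑ i, majorityWeight p i (r i) = n := by
  have : ∀ i, majorityWeight p i (r i) = if some (r i) ≠ majority p i then 0 else 1 := by
    intro i
    have := countP_true_add_countP_false p i
    unfold majorityWeight majority
    cases r i <;> split_ifs <;> first | rfl | omega | simp_all
  simp only [this]
  rw [hammingToPartial, Finset.card_filter, ← Finset.sum_add_distrib]
  trans ∑ _i : Fin n, 1
  · refine Finset.sum_congr rfl fun i _ => ?_
    split_ifs <;> rfl
  · simp

theorem outcome_eq_true_iff (F : Procedure) (I : DNNFInstance) :
    outcome F I = true ↔ ∃ r ∈ F I.n I.circuit I.profile, I.query.AgreesWith r := by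
  classical
  unfold outcome
  exact decide_eq_true_iff

theorem outcome_kemeny (I : DNNFInstance) : outcome kemeny I = answer support I.encode := by
  rw [Bool.eq_iff_iff,
    answer_encode_eq_true_iff (support_encode I) fun i b => List.countP_le_length,
    outcome_eq_true_iff]
  simp only [kemeny, scoringProcedure, Set.mem_ofPred_eq, totalScore_litVal]
  exact exists_congr fun r => by tauto

theorem outcome_slater (I : DNNFInstance) : outcome slater I = answer majoritySupport I.encode := by
  have hW : ∀ (i : Fin I.n) (b : Bool),
      majoritySupport I.encode i b = majorityWeight I.profile i b := by
    intro i b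
    rw [majoritySupport, support_encode, ballotWords_encode, List.length_map, ← Nat.two_mul,
      majorityWeight, Bool.cond_decide]
  have hw : ∀ i b, majorityWeight I.profile i b ≤ I.profile.length := by
    intro i b
    have := List.length_pos_of_ne_nil I.profile_ne_nil
    unfold majorityWeight
    split_ifs <;> omega
  rw [Bool.eq_iff_iff, answer_encode_eq_true_iff hW hw, outcome_eq_true_iff]
  have key : ∀ r r' : Ballot I.n,
      hammingToPartial r (majority I.profile) ≤ hammingToPartial r' (majority I.profile) ↔
        ∑ i, majorityWeight I.profile i (r' i) ≤ ∑ i, majorityWeight I.profile i (r i) := by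
    intro r r'
    have := hammingToPartial_add I.profile r
    have := hammingToPartial_add I.profile r'
    omega
  simp only [slater, Set.mem_ofPred_eq, key]
  exact exists_congr fun r => by tauto

end JudgmentAggregation

theorem mainTheorem4 :
    Nonempty (Turing.TM2ComputableInPolyTime
      JudgmentAggregation.DNNFInstance.encode Computability.encodeBool
      (JudgmentAggregation.outcome JudgmentAggregation.kemeny)) ∧
    Nonempty (Turing.TM2ComputableInPolyTime
      JudgmentAggregation.DNNFInstance.encode Computability.encodeBool
      (JudgmentAggregation.outcome JudgmentAggregation.slater)) := by
  open JudgmentAggregation in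
  rw [show outcome kemeny = _ from funext outcome_kemeny,
    show outcome slater = _ from funext outcome_slater]
  exact ⟨(polyTime_answer polyTime_support).computable _,
    (polyTime_answer polyTime_majoritySupport).computable _⟩
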